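/- Let $(\mathcal S,\mathcal A,P,r,\mu,\gamma)$ be a finite Markov decision process with $\mathcal A\neq\emptyset$, rewards $r(s,a)\in[0,1]$, discount $\gamma\in[0,1)$ and initial distribution $\mu$ with $\mu(s)>0$ for all $s\in\mathcal S$; let $\lambda>0$. For a policy $\pi$ put $$V_\lambda^\pi(s)=\mathbb E_\pi\Big[\sum_{t\ge0}\gamma^t\Big(r(s_t,a_t)-\lambda\sum_{a}\pi(a|s_t)\log\pi(a|s_t)\Big)\Big|\,s_0=s\Big],\qquad J(\pi,\lambda)=V^\pi_\lambda(\mu)=\sum_s\mu(s)V_\lambda^\pi(s),$$ and $d_{\pi,\mu}(s)=(1-\gamma)\sum_{t\ge0}\gamma^t\,\mathbb P^\pi(s_t=s\mid s_0\sim\mu)$. Then a policy $\pi_\lambda^*$ maximizing $J(\cdot,\lambda)$ over all policies exists. For every such $\pi_\lambda^*$ the following holds; write $V_\lambda^*=V_\lambda^{\pi_\lambda^*}$. For $\theta\in\mathbb R^{\mathcal S\times\mathcal A}$ let $\pi_\theta(a|s)=e^{\theta(s,a)}/\sum_{a'}e^{\theta(s,a')}$. For any $\theta_0\in\mathbb R^{\mathcal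 S\times\mathcal A}$ run policy gradient $\theta_{t+1}=\theta_t+\eta\nabla_\theta J(\pi_{\theta},\lambda)|_{\theta=\theta_t}$ with learning rate $\eta=\frac{(1-\gamma)^3}{8+\lambda(4+8\log|\mathcal A|)}$, and write $\pi_t=\pi_{\theta_t}$. Let $$c_\lambda=\inf_{t\ge1}\min_{s,a}\pi_t(a|s)^2,\qquad C_\lambda=\frac{c_\lambda(1-\gamma)^4\min_s\mu(s)}{(8/\lambda+4+8\log|\mathcal A|)\,|\mathcal S|}\left\|\frac{d_{\pi^*_\lambda,\mu}}{\mu}\right\|_\infty^{-1},\qquad \mathrm{Time}(\lambda)=\frac1{C_\lambda}\log\left(\frac{4\|1/\mu\|_\infty}{1-\gamma}\right).$$ Then $C_\lambda>0$, and policy gradient satisfies Prop-I with $\hat\varepsilon=0$ in time $\mathrm{Time}(\lambda)$, time being counted in gradient iterations: for every $\theta_0$, every integer $T\ge\mathrm{Time}(\lambda)$ and every state $s$, $$V_\lambda^*(s)-V_\lambda^{\pi_T}(s)\le\tfrac14\left(V_\lambda^*(\mu)-V_\lambda^{\pi_0}(\mu)\right).$$ -/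

import Mathlib

noncomputable section

/-- A finite discounted Markov decision process with rewards in `[0, 1]`: transition
probabilities `P s a s'`, rewards `r s a`, initial state distribution `μ`, discount `γ ∈ [0, 1)`. -/
structure FiniteMDP (S A : Type*) [Fintype S] where
  P : S → A → S → ℝ
  P_mem : ∀ s a, P s a ∈ stdSimplex ℝ S
  r : S → A → ℝ
  r_mem : ∀ s a, r s a ∈ Set.Icc (0 : ℝ) 1
  μ : S → ℝ
  μ_mem : μ ∈ stdSimplex ℝ S
  γ : ℝ
  γ_mem : γ ∈ Set.Ico (0 : ℝ) 1

/-- A stationary randomized policy: `π s a` is the probability of action `a` in state `s`. -/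
def IsPolicy {S A : Type*} [Fintype A] (π : S → A → ℝ) : Prop :=
  ∀ s, π s ∈ stdSimplex ℝ A

/-- The regularizer `Ω(p) = ∑ a, p a log (p a)`, the negative Shannon entropy (`0 log 0 = 0`). -/
def negEntropy {A : Type*} [Fintype A] (p : A → ℝ) : ℝ :=
  ∑ a, p a * Real.log (p a)

/-- The softmax policy of the parameter `θ ∈ ℝ^(S × A)`. -/
def softmaxPolicy {S A : Type*} [Fintype A] (θ : EuclideanSpace ℝ (S × A)) : S → A → ℝ :=
  fun s a => Real.exp (θ (s, a)) / ∑ a', Real.exp (θ (s, a'))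

namespace FiniteMDP

variable {S A : Type*} [Fintype S] [DecidableEq S] [Fintype A] (M : FiniteMDP S A)

/-- The one-step state transition matrix under `π`. Its `t`-th power has the entries
`ℙ^π (s_t = s' | s_0 = s)`. -/
def transMatrix (π : S → A → ℝ) : Matrix S S ℝ :=
  Matrix.of fun s s' => ∑ a, π s a * M.P s a s'

/-- `V_lam^π(s) = 𝔼[∑_t γ^t (r(s_t, a_t) - lam Ω(π(·|s_t))) | s_0 = s]`, the expectation of the
`t`-th term being taken under the law of `(s_t, a_t)`. -/
def value (lam : ℝ) (π : S → A → ℝ) (s : S) : ℝ :=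
  ∑' t : ℕ, M.γ ^ t *
    ∑ s', (M.transMatrix π ^ t) s s' *
      ∑ a, π s' a * (M.r s' a - lam * negEntropy (π s'))

/-- `J(π, lam) = V_lam^π(μ)`. -/
def objective (lam : ℝ) (π : S → A → ℝ) : ℝ :=
  ∑ s, M.μ s * M.value lam π s

/-- `π` maximizes `J(·, lam)` over all policies. -/
def IsOptimalPolicy (lam : ℝ) (π : S → A → ℝ) : Prop :=
  IsPolicy π ∧ ∀ π' : S → A → ℝ, IsPolicy π' → M.objective lam π' ≤ M.objective lam π

/-- The discounted state visitation distribution of `π` with `s_0 ∼ μ`. -/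
def visitation (π : S → A → ℝ) (s : S) : ℝ :=
  ∑ s₀, M.μ s₀ * ((1 - M.γ) * ∑' t : ℕ, M.γ ^ t * (M.transMatrix π ^ t) s₀ s)

/-- Gradient ascent with step size `η` on `θ ↦ J(π_θ, lam)`, started at `θ₀`; the parameter after
`t` iterations. -/
def pgParam (lam η : ℝ) (θ₀ : EuclideanSpace ℝ (S × A)) : ℕ → EuclideanSpace ℝ (S × A)
  | 0 => θ₀
  | t + 1 => pgParam lam η θ₀ t +
      η • gradient (fun θ : EuclideanSpace ℝ (S × A) => M.objective lam (softmaxPolicy θ))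
        (pgParam lam η θ₀ t)

/-- The learning rate `(1 - γ)³ / (8 + lam (4 + 8 log |A|))`. -/
def pgRate (lam : ℝ) : ℝ :=
  (1 - M.γ) ^ 3 / (8 + lam * (4 + 8 * Real.log (Fintype.card A)))

/-- The policy output by policy gradient started at `θ₀` after `t` iterations. -/
def pgPolicy (lam : ℝ) (θ₀ : EuclideanSpace ℝ (S × A)) (t : ℕ) : S → A → ℝ :=
  softmaxPolicy (M.pgParam lam (M.pgRate lam) θ₀ t)

/-- `c_lam = inf_{t ≥ 1} min_{s, a} π_t(a|s)²` along the policy gradient iterates. -/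
def pgMinProbSq (lam : ℝ) (θ₀ : EuclideanSpace ℝ (S × A)) : ℝ :=
  ⨅ t : ℕ, ⨅ s : S, ⨅ a : A, M.pgPolicy lam θ₀ (t + 1) s a ^ 2

/-- The rate `C_lam`, where `πstar` is the optimal policy. -/
def pgConst (lam : ℝ) (πstar : S → A → ℝ) (θ₀ : EuclideanSpace ℝ (S × A)) : ℝ :=
  M.pgMinProbSq lam θ₀ * (1 - M.γ) ^ 4 * (⨅ s, M.μ s) /
      ((8 / lam + 4 + 8 * Real.log (Fintype.card A)) * Fintype.card S) *
    ‖fun s => M.visitation πstar s / M.μ s‖⁻¹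

/-- `Time(lam) = (1 / C_lam) log (4 ‖1/μ‖_∞ / (1 - γ))`, in gradient iterations. -/
def pgTime (lam : ℝ) (πstar : S → A → ℝ) (θ₀ : EuclideanSpace ℝ (S × A)) : ℝ :=
  1 / M.pgConst lam πstar θ₀ * Real.log (4 * ‖fun s => 1 / M.μ s‖ / (1 - M.γ))

/-- An iterative algorithm, `alg x T` being the policy it outputs after `T` iterations from the
start `x` (so that `alg x 0` is the starting policy), satisfies Prop-I with error `εhat` in time
`time`: from every start, after any number `T ≥ time` of iterations, the output `π₁` satisfies
`V_lam^* - V_lam^π₁ ≤ (V_lam^*(μ) - V_lam^π₀(μ)) / 4 + εhat` in every state, where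
`V_lam^* = V_lam^πstar`. -/
def SatisfiesPropI {X : Type*} (lam : ℝ) (πstar : S → A → ℝ) (alg : X → ℕ → S → A → ℝ)
    (time : X → ℝ) (εhat : ℝ) : Prop :=
  ∀ (x : X) (T : ℕ), time x ≤ T → ∀ s : S,
    M.value lam πstar s - M.value lam (alg x T) s ≤
      1 / 4 * (M.objective lam πstar - M.objective lam (alg x 0)) + εhat

end FiniteMDP

end

/-! Policy gradient is gradient ascent on a smooth function satisfying a Łojasiewicz inequality, so
the suboptimality decays geometrically.

Smoothness. `value_sub_value` expresses a difference of values through the resolvent of the new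
policy. `objective_sub_objective` moves the reference to the old policy, at the cost of a term that
is a product of two first-order changes. Statewise this leaves an entropy-regularized bandit in the
logits, whose second derivative is bounded below (`regGain_softmaxVec_add_ge`). The resulting
quadratic lower bound `objective_softmaxPolicy_add_ge`, together with continuity of the candidate
`pgGrad`, also proves that `pgGrad` is the gradient (`hasGradientAt_of_lower_bound`); no value
function is ever differentiated. With the given rate, each step gains at least 3/4 η‖∇J‖²
(`objective_pgPolicy_succ_ge`).

Łojasiewicz. Gibbs' variational principle and Hoeffding's bound control the regularized one-step gap
by squared advantages (`regGain_sub_regGain_softmaxVec_le`). The gradient entries are advantages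
weighted by occupancy and action probability, so ‖∇J‖² dominates the gap (`lojasiewicz`).

Nondegeneracy. The constant is positive because the iterates stay away from the boundary
(`exists_pos_le_pgPolicy`): the entropy term pushes up any very small probability, and the row sums
of θ are conserved.

Conclusion. The gap contracts by 1 - (3/2)C per step from the first iterate on. The spare factor 3/2
pays for the initial step, to which the infimum over t ≥ 1 does not apply. Since an optimal policy
is optimal in every state, dividing by μ(s) turns the averaged bound into a statewise one. -/

noncomputable section

set_option linter.unusedSectionVars false

open Matrix Filter Topology

/-! ### Resolvent, occupancy measure and performance difference. -/

namespace FiniteMDP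

variable {S A : Type*} [Fintype S] [DecidableEq S] [Fintype A] (M : FiniteMDP S A)

theorem discount_nonneg : 0 ≤ M.γ := M.γ_mem.1

theorem one_sub_discount_pos : 0 < 1 - M.γ := sub_pos.2 M.γ_mem.2

variable {M} in
theorem transMatrix_nonneg {π : S → A → ℝ} (hπ : IsPolicy π) (s s' : S) :
    0 ≤ M.transMatrix π s s' :=
  Finset.sum_nonneg fun a _ => mul_nonneg ((hπ s).1 a) ((M.P_mem s a).1 s')

variable {M} in
theorem sum_transMatrix {π : S → A → ℝ} (hπ : IsPolicy π) (s : S) :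
    ∑ s', M.transMatrix π s s' = 1 := by
  simp only [transMatrix, of_apply]
  rw [Finset.sum_comm]
  simp_rw [← Finset.mul_sum, (M.P_mem _ _).2, mul_one]
  exact (hπ s).2

theorem transMatrix_mulVec (π : S → A → ℝ) (x : S → ℝ) (s : S) :
    (M.transMatrix π *ᵥ x) s = ∑ a, π s a * ∑ s', M.P s a s' * x s' := by
  simp only [transMatrix, mulVec, dotProduct, of_apply, Finset.sum_mul, Finset.mul_sum]
  rw [Finset.sum_comm]
  simp_rw [mul_assoc]

variable {M} in
theorem transMatrix_pow_nonneg {π : S → A → ℝ} (hπ : IsPolicy π) (t : ℕ) :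
    ∀ s s' : S, 0 ≤ (M.transMatrix π ^ t) s s' := by
  induction t with
  | zero =>
    intro s s'
    rw [pow_zero, one_apply]
    split_ifs <;> norm_num
  | succ t ih =>
    intro s s'
    rw [pow_succ, mul_apply]
    exact Finset.sum_nonneg fun i _ => mul_nonneg (ih _ _) (transMatrix_nonneg hπ _ _)

variable {M} in
theorem sum_transMatrix_pow {π : S → A → ℝ} (hπ : IsPolicy π) (t : ℕ) (s : S) :
    ∑ s', (M.transMatrix π ^ t) s s' = 1 := by
  induction t with
  | zero => simp [one_apply]
  | succ t ih =>
    simp_rw [pow_succ, mul_apply]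
    rw [Finset.sum_comm]
    simp_rw [← Finset.mul_sum, sum_transMatrix hπ, mul_one]
    exact ih

variable {M} in
theorem transMatrix_pow_le_one {π : S → A → ℝ} (hπ : IsPolicy π) (t : ℕ) (s s' : S) :
    (M.transMatrix π ^ t) s s' ≤ 1 := by
  rw [← sum_transMatrix_pow hπ t s]
  exact Finset.single_le_sum (f := fun s' => (M.transMatrix π ^ t) s s')
    (fun i _ => transMatrix_pow_nonneg hπ t s i) (Finset.mem_univ s')

variable {M} in
theorem norm_discounted_le {π : S → A → ℝ} (hπ : IsPolicy π) (t : ℕ) (s s' : S) :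
    ‖M.γ ^ t * (M.transMatrix π ^ t) s s'‖ ≤ M.γ ^ t := by
  rw [Real.norm_of_nonneg (mul_nonneg (pow_nonneg M.discount_nonneg t)
    (transMatrix_pow_nonneg hπ t s s'))]
  exact mul_le_of_le_one_right (pow_nonneg M.discount_nonneg t) (transMatrix_pow_le_one hπ t s s')

theorem summable_discount : Summable fun t : ℕ => M.γ ^ t :=
  summable_geometric_of_lt_one M.γ_mem.1 M.γ_mem.2

variable {M} in
theorem summable_discounted {π : S → A → ℝ} (hπ : IsPolicy π) (s s' : S) :
    Summable fun t : ℕ => M.γ ^ t * (M.transMatrix π ^ t) s s' :=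
  M.summable_discount.of_norm_bounded fun t => norm_discounted_le hπ t s s'

/-- The resolvent `∑_t γ^t P_π^t` of the state chain under `π`. -/
def resolvent (π : S → A → ℝ) : Matrix S S ℝ :=
  Matrix.of fun s s' => ∑' t : ℕ, M.γ ^ t * (M.transMatrix π ^ t) s s'

variable {M} in
theorem resolvent_eq_one_add {π : S → A → ℝ} (hπ : IsPolicy π) :
    M.resolvent π = 1 + M.γ • (M.transMatrix π * M.resolvent π) := by
  ext s s'
  simp only [resolvent, Matrix.add_apply, Matrix.smul_apply, mul_apply, of_apply, smul_eq_mul]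
  rw [(summable_discounted hπ s s').tsum_eq_zero_add]
  congr 1
  · simp
  · simp_rw [← tsum_mul_left]
    rw [← Summable.tsum_finsetSum fun i _ => (summable_discounted hπ i s').mul_left _,
      ← tsum_mul_left]
    refine tsum_congr fun t => ?_
    rw [pow_succ' (M.transMatrix π), mul_apply, Finset.mul_sum, Finset.mul_sum]
    refine Finset.sum_congr rfl fun i _ => ?_
    ring

variable {M} in
theorem sub_mul_resolvent {π : S → A → ℝ} (hπ : IsPolicy π) :
    (1 - M.γ • M.transMatrix π) * M.resolvent π = 1 := by
  rw [sub_mul, one_mul, smul_mul_assoc, sub_eq_iff_eq_add]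
  exact resolvent_eq_one_add hπ

variable {M} in
theorem resolvent_mul_sub {π : S → A → ℝ} (hπ : IsPolicy π) :
    M.resolvent π * (1 - M.γ • M.transMatrix π) = 1 :=
  mul_eq_one_comm.1 (sub_mul_resolvent hπ)

variable {M} in
/-- Solving the discounted Poisson equation. -/
theorem eq_resolvent_mulVec {π : S → A → ℝ} (hπ : IsPolicy π) {x w : S → ℝ}
    (h : ∀ s, x s = w s + M.γ * (M.transMatrix π *ᵥ x) s) : x = M.resolvent π *ᵥ w := by
  have : w = (1 - M.γ • M.transMatrix π) *ᵥ x := by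
    ext s
    rw [sub_mulVec, one_mulVec, smul_mulVec, Pi.sub_apply, Pi.smul_apply, smul_eq_mul]
    linarith [h s]
  rw [this, mulVec_mulVec, resolvent_mul_sub hπ, one_mulVec]

variable {M} in
theorem resolvent_mulVec_apply {π : S → A → ℝ} (hπ : IsPolicy π) (w : S → ℝ) (s : S) :
    (M.resolvent π *ᵥ w) s =
      w s + M.γ * (M.transMatrix π *ᵥ (M.resolvent π *ᵥ w)) s := by
  conv_lhs => rw [resolvent_eq_one_add hπ]
  rw [add_mulVec, one_mulVec, smul_mulVec, mulVec_mulVec]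
  rfl

variable {M} in
theorem resolvent_nonneg {π : S → A → ℝ} (hπ : IsPolicy π) (s s' : S) :
    0 ≤ M.resolvent π s s' :=
  tsum_nonneg fun t => mul_nonneg (pow_nonneg M.discount_nonneg t)
    (transMatrix_pow_nonneg hπ t s s')

variable {M} in
theorem one_le_resolvent_diag {π : S → A → ℝ} (hπ : IsPolicy π) (s : S) :
    1 ≤ M.resolvent π s s := by
  rw [resolvent_eq_one_add hπ, Matrix.add_apply, one_apply_eq, Matrix.smul_apply, mul_apply,
    smul_eq_mul]
  exact le_add_of_nonneg_right (mul_nonneg M.discount_nonneg (Finset.sum_nonneg fun i _ =>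
    mul_nonneg (transMatrix_nonneg hπ _ _) (resolvent_nonneg hπ _ _)))

variable {M} in
theorem sum_resolvent {π : S → A → ℝ} (hπ : IsPolicy π) (s : S) :
    ∑ s', M.resolvent π s s' = 1 / (1 - M.γ) := by
  have h : (fun _ : S => 1 / (1 - M.γ)) = M.resolvent π *ᵥ fun _ => 1 := by
    refine eq_resolvent_mulVec hπ fun s => ?_
    have := M.one_sub_discount_pos
    simp only [mulVec, dotProduct, ← Finset.sum_mul, sum_transMatrix hπ]
    field_simp
    ring
  have := congrFun h s
  simp only [mulVec, dotProduct, mul_one] at this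
  exact this.symm

variable {M} in
theorem resolvent_mulVec_nonneg {π : S → A → ℝ} (hπ : IsPolicy π) {w : S → ℝ}
    (hw : ∀ s, 0 ≤ w s) (s : S) : 0 ≤ (M.resolvent π *ᵥ w) s :=
  Finset.sum_nonneg fun i _ => mul_nonneg (resolvent_nonneg hπ _ _) (hw i)

variable {M} in
theorem le_resolvent_mulVec {π : S → A → ℝ} (hπ : IsPolicy π) {w : S → ℝ}
    (hw : ∀ s, 0 ≤ w s) (s : S) : w s ≤ (M.resolvent π *ᵥ w) s := by
  calc w s ≤ M.resolvent π s s * w s :=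
        le_mul_of_one_le_left (hw s) (one_le_resolvent_diag hπ s)
    _ ≤ _ := Finset.single_le_sum (f := fun i => M.resolvent π s i * w i)
        (fun i _ => mul_nonneg (resolvent_nonneg hπ _ _) (hw i)) (Finset.mem_univ s)

variable {M} in
theorem resolvent_mulVec_le {π : S → A → ℝ} (hπ : IsPolicy π) {w : S → ℝ} {c : ℝ}
    (hw : ∀ s, w s ≤ c) (s : S) : (M.resolvent π *ᵥ w) s ≤ c / (1 - M.γ) := by
  calc (M.resolvent π *ᵥ w) s ≤ ∑ i, M.resolvent π s i * c :=
        Finset.sum_le_sum fun i _ => mul_le_mul_of_nonneg_left (hw i) (resolvent_nonneg hπ _ _)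
    _ = c / (1 - M.γ) := by rw [← Finset.sum_mul, sum_resolvent hπ]; ring

variable {M} in
theorem abs_resolvent_mulVec_le {π : S → A → ℝ} (hπ : IsPolicy π) {w : S → ℝ} {c : ℝ}
    (hw : ∀ s, |w s| ≤ c) (s : S) : |(M.resolvent π *ᵥ w) s| ≤ c / (1 - M.γ) := by
  rw [abs_le]
  constructor
  · have := resolvent_mulVec_le (M := M) hπ (w := -w) (fun s => (neg_le_abs (w s)).trans (hw s)) s
    rw [mulVec_neg, Pi.neg_apply] at this
    linarith
  · exact resolvent_mulVec_le hπ (fun s => (le_abs_self (w s)).trans (hw s)) s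

/-- The regularized one-step reward of `π`. -/
def regReward (lam : ℝ) (π : S → A → ℝ) (s : S) : ℝ :=
  ∑ a, π s a * (M.r s a - lam * negEntropy (π s))

variable {M} in
theorem value_eq {π : S → A → ℝ} (hπ : IsPolicy π) (lam : ℝ) :
    M.value lam π = M.resolvent π *ᵥ M.regReward lam π := by
  ext s
  simp only [value, resolvent, regReward, mulVec, dotProduct, of_apply, ← tsum_mul_right]
  rw [← Summable.tsum_finsetSum fun i _ => (summable_discounted hπ s i).mul_right _]
  refine tsum_congr fun t => ?_
  rw [Finset.mul_sum]
  simp_rw [mul_assoc]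

/-- The unnormalized discounted visitation measure of `π` from `μ`. -/
def occupancy (π : S → A → ℝ) (s : S) : ℝ :=
  ∑ s₀, M.μ s₀ * M.resolvent π s₀ s

theorem visitation_eq (π : S → A → ℝ) (s : S) :
    M.visitation π s = (1 - M.γ) * M.occupancy π s := by
  simp only [visitation, occupancy, resolvent, of_apply, Finset.mul_sum]
  exact Finset.sum_congr rfl fun i _ => by ring

theorem sum_init_mul_resolvent_mulVec (π : S → A → ℝ) (w : S → ℝ) :
    ∑ s, M.μ s * (M.resolvent π *ᵥ w) s = ∑ s, M.occupancy π s * w s := by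
  simp only [mulVec, dotProduct, occupancy, Finset.mul_sum, Finset.sum_mul]
  rw [Finset.sum_comm]
  simp_rw [mul_assoc]

variable {M} in
theorem init_le_occupancy {π : S → A → ℝ} (hπ : IsPolicy π) (s : S) :
    M.μ s ≤ M.occupancy π s := by
  calc M.μ s ≤ M.μ s * M.resolvent π s s :=
        le_mul_of_one_le_right (M.μ_mem.1 s) (one_le_resolvent_diag hπ s)
    _ ≤ _ := Finset.single_le_sum (f := fun i => M.μ i * M.resolvent π i s)
        (fun i _ => mul_nonneg (M.μ_mem.1 i) (resolvent_nonneg hπ _ _)) (Finset.mem_univ s)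

variable {M} in
theorem occupancy_nonneg {π : S → A → ℝ} (hπ : IsPolicy π) (s : S) : 0 ≤ M.occupancy π s :=
  (M.μ_mem.1 s).trans (init_le_occupancy hπ s)

variable {M} in
theorem sum_occupancy {π : S → A → ℝ} (hπ : IsPolicy π) :
    ∑ s, M.occupancy π s = 1 / (1 - M.γ) := by
  simp only [occupancy]
  rw [Finset.sum_comm]
  simp_rw [← Finset.mul_sum, sum_resolvent hπ, ← Finset.sum_mul, M.μ_mem.2, one_mul]

variable {M} in
theorem occupancy_le {π : S → A → ℝ} (hπ : IsPolicy π) (s : S) :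
    M.occupancy π s ≤ 1 / (1 - M.γ) := by
  rw [← sum_occupancy hπ]
  exact Finset.single_le_sum (f := M.occupancy π)
    (fun i _ => occupancy_nonneg hπ i) (Finset.mem_univ s)

/-- The state-action value `r(s, a) + γ ∑ P(s' | s, a) V(s')`. -/
def qValue (lam : ℝ) (π : S → A → ℝ) (s : S) (a : A) : ℝ :=
  M.r s a + M.γ * ∑ s', M.P s a s' * M.value lam π s'

/-- The regularized value `∑ p Q - lam Ω(p)` of the action distribution `p` for the gains `Q`. -/
def _root_.regGain (lam : ℝ) (Q p : A → ℝ) : ℝ :=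
  ∑ a, p a * Q a - lam * negEntropy p

theorem regGain_qValue {π' : S → A → ℝ} (hπ' : IsPolicy π') (lam : ℝ) (π : S → A → ℝ) (s : S) :
    regGain lam (M.qValue lam π s) (π' s) =
      M.regReward lam π' s + M.γ * (M.transMatrix π' *ᵥ M.value lam π) s := by
  rw [transMatrix_mulVec]
  simp only [regGain, qValue, regReward, mul_add, mul_sub, Finset.sum_add_distrib,
    Finset.sum_sub_distrib, ← Finset.sum_mul, (hπ' s).2, one_mul, Finset.mul_sum]
  simp only [mul_left_comm]
  ring

variable {M} in
theorem value_eq_regGain {π : S → A → ℝ} (hπ : IsPolicy π) (lam : ℝ) (s : S) :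
    M.value lam π s = regGain lam (M.qValue lam π s) (π s) := by
  rw [regGain_qValue M hπ, value_eq hπ]
  exact resolvent_mulVec_apply hπ _ s

variable {M} in
/-- The performance difference identity. -/
theorem value_sub_value {π π' : S → A → ℝ} (hπ' : IsPolicy π') (lam : ℝ) :
    M.value lam π' - M.value lam π = M.resolvent π' *ᵥ
      fun s => regGain lam (M.qValue lam π s) (π' s) - M.value lam π s := by
  -- The difference solves the Poisson equation of `π'` whose reward is the one-step gain of `π'`
  -- over the value of `π`.
  refine eq_resolvent_mulVec hπ' fun s => ?_
  have h := value_eq_regGain (M := M) hπ' lam s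
  rw [regGain_qValue M hπ'] at h ⊢
  rw [mulVec_sub, Pi.sub_apply, Pi.sub_apply, h]
  ring

end FiniteMDP

/-! ### The entropy-regularized bandit with softmax distributions. -/

section Softmax

variable {A : Type*} [Fintype A]

/-- The softmax distribution of the logits `z`. -/
def softmaxVec (z : A → ℝ) (a : A) : ℝ :=
  Real.exp (z a) / ∑ b, Real.exp (z b)

theorem regGain_eq (lam : ℝ) (Q p : A → ℝ) :
    regGain lam Q p = ∑ a, p a * (Q a - lam * Real.log (p a)) := by
  simp only [regGain, negEntropy, mul_sub, Finset.sum_sub_distrib, Finset.mul_sum, mul_left_comm]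

variable [Nonempty A]

theorem sum_exp_pos (z : A → ℝ) : 0 < ∑ a, Real.exp (z a) :=
  Finset.sum_pos (fun _ _ => Real.exp_pos _) Finset.univ_nonempty

theorem softmaxVec_pos (z : A → ℝ) (a : A) : 0 < softmaxVec z a :=
  div_pos (Real.exp_pos _) (sum_exp_pos z)

theorem sum_softmaxVec (z : A → ℝ) : ∑ a, softmaxVec z a = 1 := by
  simp only [softmaxVec, ← Finset.sum_div]
  exact div_self (sum_exp_pos z).ne'

theorem softmaxVec_mem (z : A → ℝ) : softmaxVec z ∈ stdSimplex ℝ A :=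
  ⟨fun a => (softmaxVec_pos z a).le, sum_softmaxVec z⟩

theorem softmaxVec_le_one (z : A → ℝ) (a : A) : softmaxVec z a ≤ 1 := by
  rw [← sum_softmaxVec z]
  exact Finset.single_le_sum (f := softmaxVec z) (fun i _ => (softmaxVec_pos z i).le)
    (Finset.mem_univ a)

theorem log_softmaxVec (z : A → ℝ) (a : A) :
    Real.log (softmaxVec z a) = z a - Real.log (∑ b, Real.exp (z b)) := by
  rw [softmaxVec, Real.log_div (Real.exp_pos _).ne' (sum_exp_pos z).ne', Real.log_exp]

/-- The Gibbs variational inequality. -/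
theorem regGain_le_log_sum_exp {lam : ℝ} (hlam : 0 < lam) (Q : A → ℝ) {p : A → ℝ}
    (hp : p ∈ stdSimplex ℝ A) :
    regGain lam Q p ≤ lam * Real.log (∑ a, Real.exp (Q a / lam)) := by
  set z : A → ℝ := fun a => Q a / lam with hz
  -- Nonnegativity of the relative entropy, term by term: log x ≤ x - 1 at x = softmax/p. The
  -- corrections `softmaxVec z a - p a` sum to zero, and p a = 0 is treated apart.
  have key : ∀ a, p a * (Q a - lam * Real.log (p a)) ≤
      lam * (p a * Real.log (∑ a, Real.exp (z a)) + (softmaxVec z a - p a)) := by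
    intro a
    rcases (hp.1 a).eq_or_lt with h | h
    · rw [← h]
      simpa using mul_nonneg hlam.le (softmaxVec_pos z a).le
    · have h1 := Real.log_le_sub_one_of_pos (div_pos (softmaxVec_pos z a) h)
      rw [Real.log_div (softmaxVec_pos z a).ne' h.ne', log_softmaxVec] at h1
      have h2 := mul_le_mul_of_nonneg_left h1 (mul_nonneg hlam.le h.le)
      have h3 : lam * p a * (softmaxVec z a / p a - 1) = lam * (softmaxVec z a - p a) := by
        field_simp
      have h4 : lam * z a = Q a := by rw [hz]; field_simp
      rw [h3] at h2
      rw [← h4]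
      linarith
  rw [regGain_eq]
  refine (Finset.sum_le_sum fun a _ => key a).trans_eq ?_
  rw [← Finset.mul_sum, Finset.sum_add_distrib, Finset.sum_sub_distrib, ← Finset.sum_mul, hp.2,
    sum_softmaxVec]
  ring

/-- The Gibbs inequality with zero gains at temperature one. -/
theorem neg_negEntropy_le {p : A → ℝ} (hp : p ∈ stdSimplex ℝ A) :
    -negEntropy p ≤ Real.log (Fintype.card A) := by
  have := regGain_le_log_sum_exp one_pos (fun _ => 0) hp
  simpa [regGain] using this

theorem negEntropy_nonpos {p : A → ℝ} (hp : p ∈ stdSimplex ℝ A) : negEntropy p ≤ 0 :=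
  Finset.sum_nonpos fun a _ => mul_nonpos_of_nonneg_of_nonpos (hp.1 a)
    (Real.log_nonpos (hp.1 a) (by
      rw [← hp.2]
      exact Finset.single_le_sum (f := p) (fun i _ => hp.1 i) (Finset.mem_univ a)))

/-- The mean of `u` under `softmaxVec z`. -/
def softmaxMean (z u : A → ℝ) : ℝ := ∑ a, softmaxVec z a * u a

/-- The gains of the regularized bandit at `softmaxVec z`. -/
def softGain (lam : ℝ) (Q z : A → ℝ) (a : A) : ℝ :=
  Q a - lam * Real.log (softmaxVec z a)

theorem regGain_softmaxVec (lam : ℝ) (Q z : A → ℝ) :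
    regGain lam Q (softmaxVec z) = softmaxMean z (softGain lam Q z) :=
  regGain_eq lam Q _

theorem sum_softmaxVec_mul_sub (z u : A → ℝ) :
    ∑ a, softmaxVec z a * (u a - softmaxMean z u) = 0 := by
  simp only [mul_sub, Finset.sum_sub_distrib, ← Finset.sum_mul, sum_softmaxVec, one_mul]
  exact sub_self _

theorem abs_softmaxMean_le {z w : A → ℝ} {c : ℝ} (hw : ∀ a, |w a| ≤ c) :
    |softmaxMean z w| ≤ c := by
  calc |softmaxMean z w| ≤ ∑ a, |softmaxVec z a * w a| := Finset.abs_sum_le_sum_abs _ _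
    _ ≤ ∑ a, softmaxVec z a * c := Finset.sum_le_sum fun a _ => by
        rw [abs_mul, abs_of_pos (softmaxVec_pos z a)]
        exact mul_le_mul_of_nonneg_left (hw a) (softmaxVec_pos z a).le
    _ = c := by rw [← Finset.sum_mul, sum_softmaxVec, one_mul]

/-- The deviation is an average of the differences u a - u b, and each of these involves only two
coordinates, whence √2. -/
theorem abs_sub_softmaxMean_le (z u : A → ℝ) (a : A) :
    |u a - softmaxMean z u| ≤ √2 * √(∑ b, u b ^ 2) := by
  have h : u a - softmaxMean z u = softmaxMean z fun b => u a - u b := by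
    simp only [softmaxMean, mul_sub, Finset.sum_sub_distrib, ← Finset.sum_mul, sum_softmaxVec,
      one_mul]
  rw [h]
  refine abs_softmaxMean_le fun b => ?_
  rw [← Real.sqrt_mul zero_le_two]
  refine Real.abs_le_sqrt ?_
  classical
  by_cases hab : a = b
  · subst hab
    simpa using Finset.sum_nonneg fun i (_ : i ∈ Finset.univ) => sq_nonneg (u i)
  · have h1 : u a ^ 2 + u b ^ 2 ≤ ∑ i, u i ^ 2 := by
      rw [← Finset.sum_pair (f := fun i => u i ^ 2) hab]
      exact Finset.sum_le_sum_of_subset_of_nonneg (Finset.subset_univ _)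
        fun i _ _ => sq_nonneg _
    nlinarith [sq_nonneg (u a + u b)]

theorem softmaxMean_sq_sub_le (z u : A → ℝ) :
    softmaxMean z (fun a => (u a - softmaxMean z u) ^ 2) ≤ ∑ b, u b ^ 2 := by
  have h : softmaxMean z (fun a => (u a - softmaxMean z u) ^ 2) =
      ∑ a, softmaxVec z a * u a ^ 2 - softmaxMean z u ^ 2 := by
    have : ∀ a, softmaxVec z a * (u a - softmaxMean z u) ^ 2 = softmaxVec z a * u a ^ 2
        - softmaxVec z a * u a * (2 * softmaxMean z u)
        + softmaxVec z a * softmaxMean z u ^ 2 := fun a => by ring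
    simp only [softmaxMean] at this ⊢
    simp only [this, Finset.sum_add_distrib, Finset.sum_sub_distrib, ← Finset.sum_mul,
      sum_softmaxVec]
    ring
  rw [h]
  have : ∑ a, softmaxVec z a * u a ^ 2 ≤ ∑ b, u b ^ 2 := Finset.sum_le_sum fun a _ =>
    mul_le_of_le_one_left (sq_nonneg _) (softmaxVec_le_one z a)
  nlinarith [sq_nonneg (softmaxMean z u)]

/-! ### Derivatives along lines of logits. -/

section Line

variable (z u : A → ℝ)

theorem hasDerivAt_log_sum_exp_line (α : ℝ) :
    HasDerivAt (fun α : ℝ => Real.log (∑ b, Real.exp ((z + α • u) b)))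
      (softmaxMean (z + α • u) u) α := by
  have h1 : HasDerivAt (fun α : ℝ => ∑ b, Real.exp ((z + α • u) b))
      (∑ b, Real.exp ((z + α • u) b) * u b) α := by
    refine HasDerivAt.fun_sum fun b _ => HasDerivAt.exp ?_
    simpa using ((hasDerivAt_id α).mul_const (u b)).const_add (z b)
  convert h1.log (sum_exp_pos _).ne' using 1
  simp only [softmaxMean, softmaxVec, Finset.sum_div]
  exact Finset.sum_congr rfl fun a _ => by ring

theorem hasDerivAt_log_softmaxVec_line (a : A) (α : ℝ) :
    HasDerivAt (fun α : ℝ => Real.log (softmaxVec (z + α • u) a))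
      (u a - softmaxMean (z + α • u) u) α := by
  simp only [log_softmaxVec]
  refine HasDerivAt.sub ?_ (hasDerivAt_log_sum_exp_line z u α)
  simpa using ((hasDerivAt_id α).mul_const (u a)).const_add (z a)

theorem hasDerivAt_softmaxVec_line (a : A) (α : ℝ) :
    HasDerivAt (fun α : ℝ => softmaxVec (z + α • u) a)
      (softmaxVec (z + α • u) a * (u a - softmaxMean (z + α • u) u)) α := by
  have h := (hasDerivAt_log_softmaxVec_line z u a α).exp
  simpa only [Real.exp_log (softmaxVec_pos _ a)] using h

theorem hasDerivAt_softmaxMean_line (α : ℝ) {w : ℝ → A → ℝ} {w' : A → ℝ}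
    (hw : ∀ a, HasDerivAt (fun α => w α a) (w' a) α) :
    HasDerivAt (fun α : ℝ => softmaxMean (z + α • u) (w α))
      (softmaxMean (z + α • u) (fun a => (u a - softmaxMean (z + α • u) u) * w α a + w' a)) α := by
  have h := HasDerivAt.fun_sum fun a (_ : a ∈ Finset.univ) =>
    (hasDerivAt_softmaxVec_line z u a α).fun_mul (hw a)
  refine h.congr_deriv ?_
  exact Finset.sum_congr rfl fun a _ => by ring

theorem hasDerivAt_softGain_line (lam : ℝ) (Q : A → ℝ) (a : A) (α : ℝ) :
    HasDerivAt (fun α : ℝ => softGain lam Q (z + α • u) a)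
      (-lam * (u a - softmaxMean (z + α • u) u)) α := by
  have := ((hasDerivAt_log_softmaxVec_line z u a α).const_mul lam).const_sub (Q a)
  simpa [softGain] using this

/-- The directional derivative of the regularized bandit objective. -/
def softSlope (lam : ℝ) (Q : A → ℝ) (z u : A → ℝ) : ℝ :=
  softmaxMean z fun a => (u a - softmaxMean z u) * softGain lam Q z a

/-- Differentiating the logarithm inside the mean contributes nothing, since the score u - mean is
centred; only the change of the weights remains. -/
theorem hasDerivAt_regGain_line (lam : ℝ) (Q : A → ℝ) (α : ℝ) :
    HasDerivAt (fun α : ℝ => regGain lam Q (softmaxVec (z + α • u)))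
      (softSlope lam Q (z + α • u) u) α := by
  simp only [regGain_softmaxVec]
  refine (hasDerivAt_softmaxMean_line z u α
    fun a => hasDerivAt_softGain_line z u lam Q a α).congr_deriv ?_
  have h := sum_softmaxVec_mul_sub (z + α • u) u
  simp only [softSlope]
  simp only [softmaxMean] at h ⊢
  have h2 : ∀ a, softmaxVec (z + α • u) a * (-lam * (u a - ∑ a, softmaxVec (z + α • u) a * u a)) =
    -lam * (softmaxVec (z + α • u) a * (u a - ∑ a, softmaxVec (z + α • u) a * u a)) :=
      fun a => by ring
  simp only [mul_add, Finset.sum_add_distrib, h2, ← Finset.mul_sum, h, mul_zero, add_zero]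

/-- The second directional derivative of the regularized bandit objective. -/
theorem hasDerivAt_softSlope_line (lam : ℝ) (Q : A → ℝ) (α : ℝ) :
    HasDerivAt (fun α : ℝ => softSlope lam Q (z + α • u) u)
      (softmaxMean (z + α • u) (fun a =>
          (u a - softmaxMean (z + α • u) u) ^ 2 * softGain lam Q (z + α • u) a)
        - softmaxMean (z + α • u) (fun a => (u a - softmaxMean (z + α • u) u) ^ 2) *
          (softmaxMean (z + α • u) (softGain lam Q (z + α • u)) + lam)) α := by
  have hm := hasDerivAt_softmaxMean_line z u α (w := fun _ => u) (w' := 0)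
    fun a => hasDerivAt_const α (u a)
  -- The derivative of the mean of u is its variance.
  have hvar : softmaxMean (z + α • u)
        (fun a => (u a - softmaxMean (z + α • u) u) * u a + (0 : A → ℝ) a) =
      softmaxMean (z + α • u) (fun a => (u a - softmaxMean (z + α • u) u) ^ 2) := by
    have h := sum_softmaxVec_mul_sub (z + α • u) u
    generalize softmaxMean (z + α • u) u = m at h ⊢
    have h2 : ∀ a, softmaxVec (z + α • u) a * (u a - m) ^ 2 =
        softmaxVec (z + α • u) a * ((u a - m) * u a + (0 : A → ℝ) a) -
          (softmaxVec (z + α • u) a * (u a - m)) * m := fun a => by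
      rw [Pi.zero_apply]; ring
    simp only [softmaxMean, h2, Finset.sum_sub_distrib, ← Finset.sum_mul, h, zero_mul, sub_zero]
  rw [hvar] at hm
  refine (hasDerivAt_softmaxMean_line z u α fun a =>
    (hm.const_sub (u a)).fun_mul (hasDerivAt_softGain_line z u lam Q a α)).congr_deriv ?_
  generalize softmaxMean (z + α • u) u = m
  generalize hv : softmaxMean (z + α • u) (fun a => (u a - m) ^ 2) = v
  have h2 : ∀ a, softmaxVec (z + α • u) a * ((u a - m) * ((u a - m) * softGain lam Q (z + α • u) a)
        + (-v * softGain lam Q (z + α • u) a + (u a - m) * (-lam * (u a - m)))) =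
      softmaxVec (z + α • u) a * ((u a - m) ^ 2 * softGain lam Q (z + α • u) a)
        - v * (softmaxVec (z + α • u) a * softGain lam Q (z + α • u) a)
        - lam * (softmaxVec (z + α • u) a * (u a - m) ^ 2) := fun a => by ring
  simp only [softmaxMean] at hv ⊢
  simp only [h2, Finset.sum_sub_distrib, ← Finset.mul_sum, hv]
  ring

end Line

theorem abs_sub_le_of_hasDerivAt_bound {g g' : ℝ → ℝ} {c : ℝ}
    (hg : ∀ x, HasDerivAt g (g' x) x) (hc : ∀ x ∈ Set.Icc (0 : ℝ) 1, |g' x| ≤ c) :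
    |g 1 - g 0| ≤ c := by
  have := (convex_Icc (0 : ℝ) 1).norm_image_sub_le_of_norm_hasDerivWithin_le
    (fun x _ => (hg x).hasDerivWithinAt) hc (Set.left_mem_Icc.2 zero_le_one)
    (Set.right_mem_Icc.2 zero_le_one)
  simpa using this

theorem taylor_lower_bound {g g' g'' : ℝ → ℝ} {c : ℝ} (hg : ∀ x, HasDerivAt g (g' x) x)
    (hg' : ∀ x, HasDerivAt g' (g'' x) x) (hc : ∀ x, -c ≤ g'' x) :
    g 0 + g' 0 - c / 2 ≤ g 1 := by
  have h1 : Monotone fun x => g' x + c * x := by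
    have hd : ∀ x, HasDerivAt (fun x => g' x + c * x) (g'' x + c) x := fun x => by
      simpa using (hg' x).fun_add ((hasDerivAt_id x).const_mul c)
    exact monotone_of_deriv_nonneg (fun x => (hd x).differentiableAt)
      fun x => by rw [(hd x).deriv]; linarith [hc x]
  have hd : ∀ x, HasDerivAt (fun x => g x - g' 0 * x + c / 2 * x ^ 2) (g' x - g' 0 + c * x) x := by
    intro x
    have := ((hg x).fun_sub ((hasDerivAt_id x).const_mul (g' 0))).fun_add
      (((hasDerivAt_id x).fun_pow 2).const_mul (c / 2))
    refine this.congr_deriv ?_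
    simp
    ring
  have h2 : MonotoneOn (fun x => g x - g' 0 * x + c / 2 * x ^ 2) (Set.Icc 0 1) := by
    refine monotoneOn_of_deriv_nonneg (convex_Icc 0 1)
      (fun x _ => (hd x).continuousAt.continuousWithinAt)
      (fun x _ => (hd x).differentiableAt.differentiableWithinAt) fun x hx => ?_
    rw [interior_Icc] at hx
    rw [(hd x).deriv]
    have := h1 hx.1.le
    simp only [mul_zero, add_zero] at this
    linarith
  have := h2 (Set.left_mem_Icc.2 zero_le_one) (Set.right_mem_Icc.2 zero_le_one) zero_le_one
  simp only at this
  linarith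

/-! ### First- and second-order bounds for the bandit. -/

section Bounds

variable {lam b : ℝ} {Q : A → ℝ}

theorem softGain_nonneg (hlam : 0 ≤ lam) (hQ : ∀ a, 0 ≤ Q a) (z : A → ℝ) (a : A) :
    0 ≤ softGain lam Q z a := by
  have h := mul_nonneg hlam (neg_nonneg.2
    (Real.log_nonpos (softmaxVec_pos z a).le (softmaxVec_le_one z a)))
  have := hQ a
  rw [softGain]
  linarith

theorem regGain_le (hlam : 0 ≤ lam) (hQ : ∀ a, Q a ≤ b) {p : A → ℝ} (hp : p ∈ stdSimplex ℝ A) :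
    regGain lam Q p ≤ b + lam * Real.log (Fintype.card A) := by
  have h1 : ∑ a, p a * Q a ≤ b := by
    calc ∑ a, p a * Q a ≤ ∑ a, p a * b :=
          Finset.sum_le_sum fun a _ => mul_le_mul_of_nonneg_left (hQ a) (hp.1 a)
      _ = b := by rw [← Finset.sum_mul, hp.2, one_mul]
  have h2 := mul_le_mul_of_nonneg_left (neg_negEntropy_le hp) hlam
  rw [regGain]
  linarith

theorem softmaxMean_softGain_le (hlam : 0 ≤ lam) (hQ : ∀ a, Q a ≤ b) (z : A → ℝ) :
    softmaxMean z (softGain lam Q z) ≤ b + lam * Real.log (Fintype.card A) := by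
  rw [← regGain_softmaxVec]
  exact regGain_le hlam hQ (softmaxVec_mem z)

/-- The gains are unbounded, since -log π is, but they are nonnegative with bounded mean. So π times
the gain serves as the weight, and u - mean is bounded uniformly. -/
theorem abs_softSlope_le (hlam : 0 ≤ lam) (hQ₀ : ∀ a, 0 ≤ Q a) (hQ : ∀ a, Q a ≤ b)
    (z u : A → ℝ) :
    |softSlope lam Q z u| ≤
      √2 * √(∑ a, u a ^ 2) * (b + lam * Real.log (Fintype.card A)) := by
  calc |softSlope lam Q z u|
      ≤ ∑ a, |softmaxVec z a * ((u a - softmaxMean z u) * softGain lam Q z a)| :=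
        Finset.abs_sum_le_sum_abs _ _
    _ ≤ ∑ a, √2 * √(∑ a, u a ^ 2) * (softmaxVec z a * softGain lam Q z a) := by
        refine Finset.sum_le_sum fun a _ => ?_
        have h := mul_nonneg (softmaxVec_pos z a).le (softGain_nonneg hlam hQ₀ z a)
        rw [mul_left_comm, abs_mul, abs_of_nonneg h]
        exact mul_le_mul_of_nonneg_right (abs_sub_softmaxMean_le z u a) h
    _ ≤ _ := by
        rw [← Finset.mul_sum]
        exact mul_le_mul_of_nonneg_left (softmaxMean_softGain_le hlam hQ z) (by positivity)

theorem abs_regGain_softmaxVec_sub_le (hlam : 0 ≤ lam) (hQ₀ : ∀ a, 0 ≤ Q a) (hQ : ∀ a, Q a ≤ b)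
    (z u : A → ℝ) :
    |regGain lam Q (softmaxVec (z + u)) - regGain lam Q (softmaxVec z)| ≤
      √2 * √(∑ a, u a ^ 2) * (b + lam * Real.log (Fintype.card A)) := by
  have := abs_sub_le_of_hasDerivAt_bound (fun x => hasDerivAt_regGain_line z u lam Q x)
    fun x _ => abs_softSlope_le hlam hQ₀ hQ (z + x • u) u
  simpa using this

/-- In the second derivative the term carrying the unbounded gains is nonnegative and is dropped;
what remains is minus a variance times a bounded mean. This is why only the lower half of smoothness
is pursued. -/
theorem regGain_softmaxVec_add_ge (hlam : 0 ≤ lam) (hQ₀ : ∀ a, 0 ≤ Q a) (hQ : ∀ a, Q a ≤ b)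
    (z u : A → ℝ) :
    regGain lam Q (softmaxVec z) + softSlope lam Q z u -
        (∑ a, u a ^ 2) * (b + lam * Real.log (Fintype.card A) + lam) / 2 ≤
      regGain lam Q (softmaxVec (z + u)) := by
  have := taylor_lower_bound (c := (∑ a, u a ^ 2) * (b + lam * Real.log (Fintype.card A) + lam))
    (fun x => hasDerivAt_regGain_line z u lam Q x)
    (fun x => hasDerivAt_softSlope_line z u lam Q x) fun x => ?_
  · simpa using this
  · set y := z + x • u
    have h1 : 0 ≤ softmaxMean y fun a => (u a - softmaxMean y u) ^ 2 * softGain lam Q y a :=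
      Finset.sum_nonneg fun a _ => mul_nonneg (softmaxVec_pos y a).le
        (mul_nonneg (sq_nonneg _) (softGain_nonneg hlam hQ₀ y a))
    have h2 := softmaxMean_sq_sub_le y u
    have h3 := softmaxMean_softGain_le hlam hQ y
    have h4 : 0 ≤ softmaxMean y (softGain lam Q y) :=
      Finset.sum_nonneg fun a _ => mul_nonneg (softmaxVec_pos y a).le
        (softGain_nonneg hlam hQ₀ y a)
    have h5 := mul_le_mul h2 (add_le_add_left h3 lam) (by positivity)
      (Finset.sum_nonneg fun a _ => sq_nonneg (u a))
    linarith

theorem abs_sum_softmaxVec_sub_le {c : A → ℝ} {k : ℝ} (hc : ∀ a, |c a| ≤ k) (z u : A → ℝ) :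
    |∑ a, (softmaxVec (z + u) a - softmaxVec z a) * c a| ≤ √2 * √(∑ a, u a ^ 2) * k := by
  have := abs_sub_le_of_hasDerivAt_bound (c := √2 * √(∑ a, u a ^ 2) * k)
    (fun x => hasDerivAt_softmaxMean_line z u x (w := fun _ => c) (w' := 0)
      fun a => hasDerivAt_const x (c a)) fun x _ => ?_
  · simpa [softmaxMean, sub_mul] using this
  · refine abs_softmaxMean_le fun a => ?_
    rw [Pi.zero_apply, add_zero, abs_mul]
    exact mul_le_mul (abs_sub_softmaxMean_le _ u a) (hc a) (abs_nonneg _) (by positivity)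

/-- The soft suboptimality of `softmaxVec z`, from Hoeffding's bound on the cumulant generating
function. -/
theorem regGain_sub_regGain_softmaxVec_le (hlam : 0 < lam) (Q : A → ℝ) (z : A → ℝ) {p : A → ℝ}
    (hp : p ∈ stdSimplex ℝ A) {m : ℝ}
    (hm : ∀ a, |softGain lam Q z a - softmaxMean z (softGain lam Q z)| ≤ m) :
    regGain lam Q p - regGain lam Q (softmaxVec z) ≤ m ^ 2 / (2 * lam) := by
  set v := softmaxMean z (softGain lam Q z) with hv
  set y : A → ℝ := fun a => (softGain lam Q z a - v) / lam with hy
  have h0 : ∑ a, softmaxVec z a * y a = 0 := by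
    have := sum_softmaxVec_mul_sub z (softGain lam Q z)
    simp only [hy, mul_div_assoc']
    rw [← Finset.sum_div, hv, this, zero_div]
  -- Turns the log-partition function of Q/λ into v/λ plus the cumulant generating function of the
  -- centred variable y under the softmax law.
  have hQ : ∀ a, Real.exp (Q a / lam) = Real.exp (v / lam) * (softmaxVec z a * Real.exp (y a)) := by
    intro a
    rw [← Real.exp_log (softmaxVec_pos z a), ← Real.exp_add, ← Real.exp_add]
    congr 1
    simp only [hy, softGain]
    field_simp
    ring
  have hm0 : 0 ≤ m := (abs_nonneg _).trans (hm (Classical.arbitrary A))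
  have hmgf : ∑ a, softmaxVec z a * Real.exp (y a) ≤ Real.exp ((m / lam) ^ 2 / 2) := by
    refine le_trans ?_ (Real.cosh_le_exp_half_sq (m / lam))
    set k := m / lam with hk
    have hyk : ∀ a, |y a| ≤ k := fun a => by
      rw [hy, hk, abs_div, abs_of_pos hlam]
      exact div_le_div_of_nonneg_right (hm a) hlam.le
    have hk0 : 0 ≤ k := div_nonneg hm0 hlam.le
    -- The chord of exp over [-k, k]; its linear part averages to zero. If k = 0 then y a = 0, so
    -- the junk quotient is harmless.
    have hexp : ∀ a, Real.exp (y a) ≤ Real.cosh k + y a * (Real.sinh k / k) := by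
      intro a
      rcases hk0.eq_or_lt with h | h
      · have := abs_nonpos_iff.1 ((hyk a).trans_eq h.symm)
        rw [this, ← h]
        simp
      · have h1 := abs_le.1 (hyk a)
        have hcv := convexOn_exp.2 (Set.mem_univ k) (Set.mem_univ (-k))
          (show 0 ≤ (k + y a) / (2 * k) from div_nonneg (by linarith) (by linarith))
          (show 0 ≤ (k - y a) / (2 * k) from div_nonneg (by linarith) (by linarith))
          (by field_simp; ring)
        have e1 : ((k + y a) / (2 * k)) • k + ((k - y a) / (2 * k)) • (-k) = y a := by
          simp only [smul_eq_mul]; field_simp; ring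
        rw [e1] at hcv
        refine hcv.trans_eq ?_
        rw [Real.cosh_eq, Real.sinh_eq]
        simp only [smul_eq_mul]
        field_simp
        ring
    calc ∑ a, softmaxVec z a * Real.exp (y a)
        ≤ ∑ a, softmaxVec z a * (Real.cosh k + y a * (Real.sinh k / k)) :=
          Finset.sum_le_sum fun a _ => mul_le_mul_of_nonneg_left (hexp a) (softmaxVec_pos z a).le
      _ = Real.cosh k := by
          simp only [mul_add, ← mul_assoc, Finset.sum_add_distrib, ← Finset.sum_mul,
            sum_softmaxVec, h0]
          ring
  have h1 := regGain_le_log_sum_exp hlam Q hp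
  have h2 : Real.log (∑ a, Real.exp (Q a / lam)) ≤ v / lam + (m / lam) ^ 2 / 2 := by
    rw [Real.log_le_iff_le_exp (sum_exp_pos _), Real.exp_add]
    simp only [hQ, ← Finset.mul_sum]
    exact mul_le_mul_of_nonneg_left hmgf (Real.exp_pos _).le
  have h3 := mul_le_mul_of_nonneg_left h2 hlam.le
  have h4 : lam * (v / lam + (m / lam) ^ 2 / 2) = v + m ^ 2 / (2 * lam) := by field_simp
  rw [regGain_softmaxVec, ← hv]
  linarith

end Bounds

end Softmax

/-- The bound at x bounds f y - f x from below; the bound at y with the opposite increment bounds it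
from above, with G y in place of G x. Continuity of G makes the discrepancy o(‖y - x‖). -/
theorem hasGradientAt_of_lower_bound {E : Type*} [NormedAddCommGroup E] [InnerProductSpace ℝ E]
    [CompleteSpace E] {f : E → ℝ} {G : E → E} {b : ℝ} (hG : Continuous G)
    (h : ∀ x u, f x + inner ℝ (G x) u - b * ‖u‖ ^ 2 ≤ f (x + u)) (x : E) :
    HasGradientAt f (G x) x := by
  rw [hasGradientAt_iff_isLittleO, Asymptotics.isLittleO_iff]
  intro c hc
  have hlim : Tendsto (fun y => |b| * ‖y - x‖ + ‖G y - G x‖) (𝓝 x) (𝓝 0) := by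
    have : Continuous fun y => |b| * ‖y - x‖ + ‖G y - G x‖ := by fun_prop
    simpa using this.tendsto x
  filter_upwards [hlim.eventually (gt_mem_nhds hc)] with y hy
  have h1 := h x (y - x)
  have h2 := h y (x - y)
  rw [add_sub_cancel] at h1 h2
  have h3 : inner ℝ (G y) (x - y) = -inner ℝ (G y - G x) (y - x) - inner ℝ (G x) (y - x) := by
    rw [← neg_sub y x, inner_neg_right, inner_sub_left]
    ring
  have h4 := real_inner_le_norm (G y - G x) (y - x)
  have h5 := mul_le_mul_of_nonneg_right hy.le (norm_nonneg (y - x))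
  have h6 := mul_le_mul_of_nonneg_right (le_abs_self b) (sq_nonneg ‖y - x‖)
  have h7 : 0 ≤ ‖G y - G x‖ * ‖y - x‖ := by positivity
  rw [norm_sub_rev x y] at h2
  rw [Real.norm_eq_abs, abs_le]
  constructor <;> nlinarith

/-! ### Continuity, the closed-form gradient and smoothness of the objective. -/

namespace FiniteMDP

variable {S A : Type*} [Fintype S] [DecidableEq S] [Fintype A] (M : FiniteMDP S A)

section Continuity

theorem continuous_transMatrix : Continuous (M.transMatrix : (S → A → ℝ) → Matrix S S ℝ) :=
  continuous_matrix fun s s' => by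
    simp only [transMatrix, of_apply]
    fun_prop

/-- Weierstrass M-test with majorant γ^t, which is available only on genuine policies. -/
theorem continuousOn_resolvent (s s' : S) :
    ContinuousOn (fun π : S → A → ℝ => M.resolvent π s s') {π | IsPolicy π} :=
  continuousOn_tsum
    (fun t => (continuous_const.mul
      ((M.continuous_transMatrix.pow t).matrix_elem s s')).continuousOn)
    M.summable_discount fun t _ hπ => norm_discounted_le hπ t s s'

theorem continuous_regReward (lam : ℝ) (s : S) :
    Continuous fun π : S → A → ℝ => M.regReward lam π s := by
  have h : Continuous fun π : S → A → ℝ => negEntropy (π s) :=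
    continuous_finsetSum _ fun a _ =>
      Real.continuous_mul_log.comp (continuous_apply_apply s a)
  simp only [regReward]
  fun_prop

theorem continuousOn_value (lam : ℝ) (s : S) :
    ContinuousOn (fun π : S → A → ℝ => M.value lam π s) {π | IsPolicy π} := by
  have h : ContinuousOn (fun π : S → A → ℝ => ∑ s', M.resolvent π s s' * M.regReward lam π s')
      {π | IsPolicy π} :=
    continuousOn_finsetSum _ fun s' _ =>
      (M.continuousOn_resolvent s s').mul (M.continuous_regReward lam s').continuousOn
  exact h.congr fun π hπ => congrFun (value_eq hπ lam) s

end Continuity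

variable [Nonempty A]

theorem _root_.isPolicy_softmaxPolicy (θ : EuclideanSpace ℝ (S × A)) :
    IsPolicy (softmaxPolicy θ) := fun s => softmaxVec_mem fun a => θ (s, a)

theorem _root_.continuous_softmaxPolicy :
    Continuous (softmaxPolicy : EuclideanSpace ℝ (S × A) → S → A → ℝ) :=
  continuous_pi fun s => continuous_pi fun a => by
    refine Continuous.div (by fun_prop) (by fun_prop) fun θ => (sum_exp_pos fun a => θ (s, a)).ne'

theorem continuous_value_softmaxPolicy (lam : ℝ) (s : S) :
    Continuous fun θ : EuclideanSpace ℝ (S × A) => M.value lam (softmaxPolicy θ) s :=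
  (M.continuousOn_value lam s).comp_continuous continuous_softmaxPolicy isPolicy_softmaxPolicy

theorem continuous_occupancy_softmaxPolicy (s : S) :
    Continuous fun θ : EuclideanSpace ℝ (S × A) => M.occupancy (softmaxPolicy θ) s :=
  continuous_finsetSum _ fun s₀ _ => continuous_const.mul
    ((M.continuousOn_resolvent s₀ s).comp_continuous continuous_softmaxPolicy
      isPolicy_softmaxPolicy)

/-- The bound `(1 + lam log |A|) / (1 - γ)` on regularized values. -/
def valueBound (lam : ℝ) : ℝ := (1 + lam * Real.log (Fintype.card A)) / (1 - M.γ)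

theorem _root_.log_card_nonneg (A : Type*) [Fintype A] : 0 ≤ Real.log (Fintype.card A) :=
  Real.log_natCast_nonneg _

variable {M} in
theorem regReward_nonneg {lam : ℝ} (hlam : 0 ≤ lam) {π : S → A → ℝ} (hπ : IsPolicy π) (s : S) :
    0 ≤ M.regReward lam π s :=
  Finset.sum_nonneg fun a _ => mul_nonneg ((hπ s).1 a) (sub_nonneg.2
    ((mul_nonpos_of_nonneg_of_nonpos hlam (negEntropy_nonpos (hπ s))).trans (M.r_mem s a).1))

variable {M} in
theorem regReward_le {lam : ℝ} (hlam : 0 ≤ lam) {π : S → A → ℝ} (hπ : IsPolicy π) (s : S) :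
    M.regReward lam π s ≤ 1 + lam * Real.log (Fintype.card A) := by
  have h := mul_le_mul_of_nonneg_left (neg_negEntropy_le (hπ s)) hlam
  calc M.regReward lam π s ≤ ∑ a, π s a * (1 + lam * Real.log (Fintype.card A)) :=
        Finset.sum_le_sum fun a _ => mul_le_mul_of_nonneg_left
          (by linarith [(M.r_mem s a).2]) ((hπ s).1 a)
    _ = _ := by rw [← Finset.sum_mul, (hπ s).2, one_mul]

variable {M} in
theorem value_nonneg {lam : ℝ} (hlam : 0 ≤ lam) {π : S → A → ℝ} (hπ : IsPolicy π) (s : S) :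
    0 ≤ M.value lam π s := by
  rw [value_eq hπ]
  exact resolvent_mulVec_nonneg hπ (regReward_nonneg hlam hπ) s

variable {M} in
theorem value_le {lam : ℝ} (hlam : 0 ≤ lam) {π : S → A → ℝ} (hπ : IsPolicy π) (s : S) :
    M.value lam π s ≤ M.valueBound lam := by
  rw [value_eq hπ]
  exact resolvent_mulVec_le hπ (regReward_le hlam hπ) s

theorem valueBound_pos {lam : ℝ} (hlam : 0 ≤ lam) : 0 < M.valueBound lam :=
  div_pos (add_pos_of_pos_of_nonneg one_pos (mul_nonneg hlam (log_card_nonneg A)))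
    M.one_sub_discount_pos

variable {M} in
theorem qValue_nonneg {lam : ℝ} (hlam : 0 ≤ lam) {π : S → A → ℝ} (hπ : IsPolicy π) (s : S)
    (a : A) : 0 ≤ M.qValue lam π s a :=
  add_nonneg (M.r_mem s a).1 (mul_nonneg M.discount_nonneg (Finset.sum_nonneg fun s' _ =>
    mul_nonneg ((M.P_mem s a).1 s') (value_nonneg hlam hπ s')))

variable {M} in
-- Shaped so that b + λ log|A| in the bandit bounds becomes exactly `valueBound`.
theorem qValue_le {lam : ℝ} (hlam : 0 ≤ lam) {π : S → A → ℝ} (hπ : IsPolicy π) (s : S)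
    (a : A) : M.qValue lam π s a ≤ M.valueBound lam - lam * Real.log (Fintype.card A) := by
  have h1 : ∑ s', M.P s a s' * M.value lam π s' ≤ M.valueBound lam := by
    calc ∑ s', M.P s a s' * M.value lam π s' ≤ ∑ s', M.P s a s' * M.valueBound lam :=
          Finset.sum_le_sum fun s' _ => mul_le_mul_of_nonneg_left (value_le hlam hπ s')
            ((M.P_mem s a).1 s')
      _ = _ := by rw [← Finset.sum_mul, (M.P_mem s a).2, one_mul]
  have h2 := mul_le_mul_of_nonneg_left h1 M.discount_nonneg
  have h3 : (1 - M.γ) * M.valueBound lam = 1 + lam * Real.log (Fintype.card A) := by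
    have := M.one_sub_discount_pos.ne'
    rw [valueBound]
    field_simp
  have := (M.r_mem s a).2
  rw [qValue]
  linarith

/-- The advantage `Q(s, a) - lam log π(a|s) - V(s)` of the softmax policy of `θ`. -/
def softAdvantage (lam : ℝ) (θ : EuclideanSpace ℝ (S × A)) (s : S) (a : A) : ℝ :=
  softGain lam (M.qValue lam (softmaxPolicy θ) s) (fun a => θ (s, a)) a -
    M.value lam (softmaxPolicy θ) s

/-- The policy gradient in closed form. -/
def pgGrad (lam : ℝ) (θ : EuclideanSpace ℝ (S × A)) : EuclideanSpace ℝ (S × A) :=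
  WithLp.toLp 2 fun x => M.occupancy (softmaxPolicy θ) x.1 *
    (softmaxPolicy θ x.1 x.2 * M.softAdvantage lam θ x.1 x.2)

theorem value_softmaxPolicy (lam : ℝ) (θ : EuclideanSpace ℝ (S × A)) (s : S) :
    M.value lam (softmaxPolicy θ) s = softmaxMean (fun a => θ (s, a))
      (softGain lam (M.qValue lam (softmaxPolicy θ) s) fun a => θ (s, a)) := by
  rw [value_eq_regGain (isPolicy_softmaxPolicy θ), ← regGain_softmaxVec]
  rfl

/-- The value is the policy mean of the soft gain, so each row is a covariance of u with the gain;
centring may be moved from the gain to u. -/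
theorem inner_pgGrad (lam : ℝ) (θ u : EuclideanSpace ℝ (S × A)) :
    inner ℝ (M.pgGrad lam θ) u = ∑ s, M.occupancy (softmaxPolicy θ) s *
      softSlope lam (M.qValue lam (softmaxPolicy θ) s) (fun a => θ (s, a)) fun a => u (s, a) := by
  rw [PiLp.inner_apply, Fintype.sum_prod_type]
  refine Finset.sum_congr rfl fun s _ => ?_
  have h1 : ∀ a, inner ℝ (M.pgGrad lam θ (s, a)) (u (s, a)) = M.occupancy (softmaxPolicy θ) s *
      (softmaxVec (fun a => θ (s, a)) a * (u (s, a) * M.softAdvantage lam θ s a)) := fun a => by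
    rw [real_inner_comm]
    simp only [pgGrad, RCLike.inner_apply, conj_trivial]
    change _ * (softmaxVec (fun a => θ (s, a)) a * _) * _ = _
    ring
  simp only [h1, ← Finset.mul_sum]
  congr 1
  simp only [softAdvantage, value_softmaxPolicy, softSlope]
  generalize (fun a => θ (s, a)) = z
  generalize softGain lam (M.qValue lam (softmaxPolicy θ) s) z = F
  simp only [softmaxMean, mul_sub, sub_mul, Finset.sum_sub_distrib, ← mul_assoc, ← Finset.sum_mul]
  congr 1
  have h2 : ∀ m, ∑ a, softmaxVec z a * m * F a = (∑ a, softmaxVec z a * F a) * m := fun m => by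
    rw [Finset.sum_mul]
    exact Finset.sum_congr rfl fun a _ => by ring
  rw [h2]
  exact mul_comm _ _

theorem continuous_pgGrad (lam : ℝ) : Continuous (M.pgGrad lam) := by
  have h1 := fun s => M.continuous_value_softmaxPolicy lam s
  have h2 := fun s => M.continuous_occupancy_softmaxPolicy s
  have h3 : ∀ s a, Continuous fun θ : EuclideanSpace ℝ (S × A) => softmaxPolicy θ s a :=
    fun s a => (continuous_apply_apply s a).comp continuous_softmaxPolicy
  have h4 : ∀ s a, Continuous fun θ : EuclideanSpace ℝ (S × A) =>
      Real.log (softmaxPolicy θ s a) := fun s a =>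
    (h3 s a).log fun θ => (softmaxVec_pos (fun a => θ (s, a)) a).ne'
  have h5 : ∀ s a, Continuous fun θ : EuclideanSpace ℝ (S × A) => M.softAdvantage lam θ s a := by
    intro s a
    change Continuous fun θ : EuclideanSpace ℝ (S × A) =>
      M.qValue lam (softmaxPolicy θ) s a - lam * Real.log (softmaxPolicy θ s a) -
        M.value lam (softmaxPolicy θ) s
    simp only [qValue]
    fun_prop
  exact (PiLp.continuous_toLp 2 _).comp (continuous_pi fun x =>
    (h2 x.1).mul ((h3 x.1 x.2).mul (h5 x.1 x.2)))

theorem _root_.sum_sq_row_le (u : EuclideanSpace ℝ (S × A)) (s : S) :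
    ∑ a, u (s, a) ^ 2 ≤ ‖u‖ ^ 2 := by
  rw [EuclideanSpace.real_norm_sq_eq, Fintype.sum_prod_type]
  exact Finset.single_le_sum (f := fun s => ∑ a, u (s, a) ^ 2)
    (fun i _ => Finset.sum_nonneg fun a _ => sq_nonneg _) (Finset.mem_univ s)

theorem _root_.sqrt_sum_sq_row_le (u : EuclideanSpace ℝ (S × A)) (s : S) :
    √(∑ a, u (s, a) ^ 2) ≤ ‖u‖ :=
  Real.sqrt_le_iff.2 ⟨norm_nonneg u, sum_sq_row_le u s⟩

variable {M} in
-- The Poisson equation of `π'` for the value difference is rewritten with the kernel of `π`, the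
-- difference of kernels being put into the reward. The occupancy is then that of the base policy,
-- as in the gradient.
theorem objective_sub_objective {π π' : S → A → ℝ} (hπ : IsPolicy π) (hπ' : IsPolicy π')
    (lam : ℝ) :
    M.objective lam π' - M.objective lam π = ∑ s, M.occupancy π s *
      (regGain lam (M.qValue lam π s) (π' s) - M.value lam π s +
        M.γ * ∑ a, (π' s a - π s a) *
          ∑ s', M.P s a s' * (M.value lam π' - M.value lam π) s') := by
  have h := value_sub_value (M := M) (π := π) hπ' lam
  rw [← sum_init_mul_resolvent_mulVec]
  simp only [objective, ← Finset.sum_sub_distrib, ← mul_sub]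
  refine Finset.sum_congr rfl fun s _ => ?_
  congr 1
  rw [← Pi.sub_apply]
  refine congrFun (eq_resolvent_mulVec hπ fun s => ?_) s
  conv_lhs => rw [h, resolvent_mulVec_apply hπ', ← h]
  simp only [transMatrix_mulVec, sub_mul, Finset.sum_sub_distrib]
  ring

/-- Smoothness of `θ ↦ J(π_θ, lam)` from below. -/
theorem objective_softmaxPolicy_add_ge {lam : ℝ} (hlam : 0 ≤ lam)
    (θ u : EuclideanSpace ℝ (S × A)) :
    M.objective lam (softmaxPolicy θ) + inner ℝ (M.pgGrad lam θ) u -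
        (2 + lam * (1 + 2 * Real.log (Fintype.card A))) / (1 - M.γ) ^ 3 * ‖u‖ ^ 2 ≤
      M.objective lam (softmaxPolicy (θ + u)) := by
  set π := softmaxPolicy θ with hπd
  set π' := softmaxPolicy (θ + u) with hπd'
  have hπ : IsPolicy π := isPolicy_softmaxPolicy θ
  have hπ' : IsPolicy π' := isPolicy_softmaxPolicy (θ + u)
  have hx := M.one_sub_discount_pos
  have hB : 0 < M.valueBound lam := M.valueBound_pos hlam
  have hγ := M.discount_nonneg
  have hV : ∀ s, M.value lam π s = regGain lam (M.qValue lam π s) (π s) :=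
    value_eq_regGain hπ lam
  have h2 : √2 * √2 = (2 : ℝ) := Real.mul_self_sqrt zero_le_two
  have hΔ : ∀ s, |regGain lam (M.qValue lam π s) (π' s) - M.value lam π s| ≤
      √2 * ‖u‖ * M.valueBound lam := by
    intro s
    rw [hV]
    refine (abs_regGain_softmaxVec_sub_le hlam (qValue_nonneg hlam hπ s)
      (qValue_le hlam hπ s) (fun a => θ (s, a)) fun a => u (s, a)).trans ?_
    rw [sub_add_cancel]
    gcongr
    exact sqrt_sum_sq_row_le u s
  have hw : ∀ s, |(M.value lam π' - M.value lam π) s| ≤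
      √2 * ‖u‖ * M.valueBound lam / (1 - M.γ) := by
    rw [value_sub_value hπ']
    exact abs_resolvent_mulVec_le hπ' hΔ
  -- Second order in u: the policy change and the value change each contribute one factor √2‖u‖.
  have hcross : ∀ s, -(2 * ‖u‖ ^ 2 * M.valueBound lam / (1 - M.γ)) ≤
      ∑ a, (π' s a - π s a) * ∑ s', M.P s a s' * (M.value lam π' - M.value lam π) s' := by
    intro s
    have hc : ∀ a, |∑ s', M.P s a s' * (M.value lam π' - M.value lam π) s'| ≤
        √2 * ‖u‖ * M.valueBound lam / (1 - M.γ) := by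
      intro a
      refine (Finset.abs_sum_le_sum_abs _ _).trans ?_
      calc ∑ s', |M.P s a s' * (M.value lam π' - M.value lam π) s'|
          ≤ ∑ s', M.P s a s' * (√2 * ‖u‖ * M.valueBound lam / (1 - M.γ)) :=
            Finset.sum_le_sum fun s' _ => by
              rw [abs_mul, abs_of_nonneg ((M.P_mem s a).1 s')]
              exact mul_le_mul_of_nonneg_left (hw s') ((M.P_mem s a).1 s')
        _ = _ := by rw [← Finset.sum_mul, (M.P_mem s a).2, one_mul]
    have h := abs_sum_softmaxVec_sub_le hc (fun a => θ (s, a)) fun a => u (s, a)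
    refine (neg_le_neg (h.trans ?_)).trans (neg_abs_le _)
    calc √2 * √(∑ a, u (s, a) ^ 2) * (√2 * ‖u‖ * M.valueBound lam / (1 - M.γ))
        ≤ √2 * ‖u‖ * (√2 * ‖u‖ * M.valueBound lam / (1 - M.γ)) := by
          gcongr
          exact sqrt_sum_sq_row_le u s
      _ = (√2 * √2) * ‖u‖ ^ 2 * M.valueBound lam / (1 - M.γ) := by ring
      _ = _ := by rw [h2]
  have hmain := objective_sub_objective (M := M) hπ hπ' lam
  have hlow : ∑ s, M.occupancy π s *
      (softSlope lam (M.qValue lam π s) (fun a => θ (s, a)) (fun a => u (s, a))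
        - (∑ a, u (s, a) ^ 2) * (M.valueBound lam + lam) / 2
        - M.γ * (2 * ‖u‖ ^ 2 * M.valueBound lam / (1 - M.γ))) ≤
      M.objective lam π' - M.objective lam π := by
    rw [hmain]
    refine Finset.sum_le_sum fun s _ => mul_le_mul_of_nonneg_left ?_ (occupancy_nonneg hπ s)
    have h1 := regGain_softmaxVec_add_ge hlam (qValue_nonneg (M := M) hlam hπ s)
      (qValue_le hlam hπ s) (fun a => θ (s, a)) fun a => u (s, a)
    rw [sub_add_cancel] at h1
    have h3 := mul_le_mul_of_nonneg_left (hcross s) hγ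
    have h4 : regGain lam (M.qValue lam π s) (softmaxVec fun a => θ (s, a)) =
      M.value lam π s := (hV s).symm
    rw [h4] at h1
    change _ ≤ regGain lam (M.qValue lam π s) (π' s) at h1
    linarith
  simp only [mul_sub, Finset.sum_sub_distrib, ← Finset.sum_mul] at hlow
  rw [sum_occupancy hπ, hπd, ← inner_pgGrad, ← hπd] at hlow
  have hsq : ∑ s, M.occupancy π s * ((∑ a, u (s, a) ^ 2) * (M.valueBound lam + lam) / 2) ≤
      1 / (1 - M.γ) * (‖u‖ ^ 2 * (M.valueBound lam + lam) / 2) := by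
    rw [EuclideanSpace.real_norm_sq_eq, Fintype.sum_prod_type, Finset.sum_mul, Finset.sum_div,
      Finset.mul_sum]
    refine Finset.sum_le_sum fun s _ => mul_le_mul_of_nonneg_right (occupancy_le hπ s) ?_
    have := Finset.sum_nonneg fun (a : A) (_ : a ∈ Finset.univ) => sq_nonneg (u (s, a))
    positivity
  -- With L = 1 + λ log|A|, the numerator (1-γ)L/2 + (1-γ)²λ/2 + 2γL is at most 2L + λ.
  have hconst : 1 / (1 - M.γ) * (‖u‖ ^ 2 * (M.valueBound lam + lam) / 2) +
      1 / (1 - M.γ) * (M.γ * (2 * ‖u‖ ^ 2 * M.valueBound lam / (1 - M.γ))) ≤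
      (2 + lam * (1 + 2 * Real.log (Fintype.card A))) / (1 - M.γ) ^ 3 * ‖u‖ ^ 2 := by
    have hH := log_card_nonneg A
    have e : 1 / (1 - M.γ) * (‖u‖ ^ 2 * (M.valueBound lam + lam) / 2) +
      1 / (1 - M.γ) * (M.γ * (2 * ‖u‖ ^ 2 * M.valueBound lam / (1 - M.γ))) =
      ((1 - M.γ) * (1 + lam * Real.log (Fintype.card A)) / 2 + (1 - M.γ) ^ 2 * lam / 2
        + 2 * M.γ * (1 + lam * Real.log (Fintype.card A))) / (1 - M.γ) ^ 3 * ‖u‖ ^ 2 := by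
      rw [valueBound]
      field_simp
    rw [e]
    refine mul_le_mul_of_nonneg_right (div_le_div_of_nonneg_right ?_ (by positivity))
      (sq_nonneg _)
    have h1 : (1 - M.γ) ^ 2 ≤ 1 := pow_le_one₀ hx.le (by linarith)
    have h3 := mul_le_mul_of_nonneg_right h1 hlam
    have h4 : 0 ≤ (1 - M.γ) * (1 + lam * Real.log (Fintype.card A)) := by positivity
    nlinarith
  linarith

theorem hasGradientAt_objective_softmaxPolicy {lam : ℝ} (hlam : 0 ≤ lam)
    (θ : EuclideanSpace ℝ (S × A)) :
    HasGradientAt (fun θ : EuclideanSpace ℝ (S × A) => M.objective lam (softmaxPolicy θ))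
      (M.pgGrad lam θ) θ :=
  hasGradientAt_of_lower_bound (M.continuous_pgGrad lam)
    (M.objective_softmaxPolicy_add_ge hlam) θ

end FiniteMDP

/-! ### Optimal policies and the Łojasiewicz inequality. -/

namespace FiniteMDP

variable {S A : Type*} [Fintype S] [DecidableEq S] [Fintype A] [Nonempty A] (M : FiniteMDP S A)

theorem nonempty_states (M : FiniteMDP S A) : Nonempty S := by
  obtain ⟨s, -⟩ := Finset.nonempty_of_sum_ne_zero (M.μ_mem.2.trans_ne one_ne_zero)
  exact ⟨s⟩

theorem exists_isOptimalPolicy (lam : ℝ) : ∃ πstar : S → A → ℝ, M.IsOptimalPolicy lam πstar := by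
  have hK : IsCompact {π : S → A → ℝ | IsPolicy π} := by
    have := isCompact_univ_pi fun _ : S => isCompact_stdSimplex ℝ A
    convert this using 1
    ext π
    simp [IsPolicy]
  have hJ : ContinuousOn (M.objective lam) {π : S → A → ℝ | IsPolicy π} :=
    continuousOn_finsetSum _ fun s _ => continuousOn_const.mul (M.continuousOn_value lam s)
  obtain ⟨π, hπ, hmax⟩ := hK.exists_isMaxOn ⟨_, isPolicy_softmaxPolicy 0⟩ hJ
  exact ⟨π, hπ, fun π' hπ' => hmax hπ'⟩

variable {M}

/-- An optimal policy admits no improvement in a single state. -/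
theorem IsOptimalPolicy.regGain_le {lam : ℝ} {πstar : S → A → ℝ}
    (h : M.IsOptimalPolicy lam πstar) (hμ : ∀ s, 0 < M.μ s) (s : S) {q : A → ℝ}
    (hq : q ∈ stdSimplex ℝ A) :
    regGain lam (M.qValue lam πstar s) q ≤ M.value lam πstar s := by
  by_contra! hlt
  -- Deviating in the single state s gives one-step gains that vanish elsewhere and are positive at
  -- s. The resolvent diagonal is at least 1 and μ(s) > 0, so the objective would strictly increase.
  set π' := Function.update πstar s q with hπd
  have hπ' : IsPolicy π' := fun s' => by
    rcases eq_or_ne s' s with rfl | hs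
    · rwa [hπd, Function.update_self]
    · rw [hπd, Function.update_of_ne hs]
      exact h.1 s'
  have hΔ : ∀ s', 0 ≤ regGain lam (M.qValue lam πstar s') (π' s') - M.value lam πstar s' := by
    intro s'
    rcases eq_or_ne s' s with rfl | hs
    · rw [hπd, Function.update_self]
      exact (sub_pos.2 hlt).le
    · rw [hπd, Function.update_of_ne hs, ← value_eq_regGain h.1, sub_self]
  have hle := fun s' => le_resolvent_mulVec (M := M) hπ' hΔ s'
  rw [← value_sub_value hπ'] at hle
  have hs := hle s
  rw [hπd, Function.update_self, ← hπd] at hs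
  refine (h.2 π' hπ').not_gt (Finset.sum_lt_sum (fun s' _ => ?_) ⟨s, Finset.mem_univ s, ?_⟩)
  · exact mul_le_mul_of_nonneg_left (sub_nonneg.1 ((hΔ s').trans (hle s'))) (hμ s').le
  · exact mul_lt_mul_of_pos_left (sub_pos.1 ((sub_pos.2 hlt).trans_le hs)) (hμ s)

/-- Maximality of the μ-average is upgraded to every state: all one-step gains over the optimal
value are nonpositive, and the resolvent is nonnegative. -/
theorem IsOptimalPolicy.value_le {lam : ℝ} {πstar : S → A → ℝ}
    (h : M.IsOptimalPolicy lam πstar) (hμ : ∀ s, 0 < M.μ s) {π : S → A → ℝ} (hπ : IsPolicy π)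
    (s : S) : M.value lam π s ≤ M.value lam πstar s := by
  have h1 := resolvent_mulVec_le (M := M) hπ (c := 0)
    (fun s => sub_nonpos.2 (h.regGain_le hμ s (hπ s))) s
  rw [← value_sub_value hπ, zero_div] at h1
  exact sub_nonpos.1 h1

theorem one_sub_discount_le_visitation_div (hμ : ∀ s, 0 < M.μ s) {π : S → A → ℝ}
    (hπ : IsPolicy π) (s : S) : 1 - M.γ ≤ M.visitation π s / M.μ s := by
  rw [le_div_iff₀ (hμ s), visitation_eq]
  exact mul_le_mul_of_nonneg_left (init_le_occupancy hπ s) M.one_sub_discount_pos.le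

theorem apply_le_norm {ι : Type*} [Fintype ι] (f : ι → ℝ) (i : ι) : f i ≤ ‖f‖ :=
  (le_abs_self _).trans (norm_le_pi_norm f i)

/-- The non-uniform Łojasiewicz inequality. -/
theorem lojasiewicz (hμ : ∀ s, 0 < M.μ s) {lam : ℝ} (hlam : 0 < lam) {πstar : S → A → ℝ}
    (hstar : IsPolicy πstar) (θ : EuclideanSpace ℝ (S × A)) {c m : ℝ} (hc : 0 ≤ c) (hm : 0 ≤ m)
    (hcπ : ∀ s a, c ≤ softmaxPolicy θ s a ^ 2) (hmμ : ∀ s, m ≤ M.μ s) :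
    2 * lam * (1 - M.γ) * m * c *
        (M.objective lam πstar - M.objective lam (softmaxPolicy θ)) ≤
      ‖fun s => M.visitation πstar s / M.μ s‖ * ‖M.pgGrad lam θ‖ ^ 2 := by
  set D := ‖fun s => M.visitation πstar s / M.μ s‖ with hD
  set π := softmaxPolicy θ with hπd
  have hπ : IsPolicy π := isPolicy_softmaxPolicy θ
  have hx := M.one_sub_discount_pos
  set Y : S → ℝ := fun s => ∑ a, M.softAdvantage lam θ s a ^ 2 with hY
  have hY0 : ∀ s, 0 ≤ Y s := fun s => Finset.sum_nonneg fun a _ => sq_nonneg _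
  have hgap : ∀ s, regGain lam (M.qValue lam π s) (πstar s) - M.value lam π s ≤
      Y s / (2 * lam) := by
    intro s
    -- The sup norm of the advantages is replaced by their ℓ² norm, to match the squared gradient
    -- norm.
    have h := regGain_sub_regGain_softmaxVec_le hlam (M.qValue lam π s) (fun a => θ (s, a))
      (hstar s) (m := √(Y s)) fun a => ?_
    · rw [Real.sq_sqrt (hY0 s)] at h
      rw [value_eq_regGain hπ]
      exact h
    · rw [← value_softmaxPolicy]
      exact Real.abs_le_sqrt (Finset.single_le_sum
        (f := fun a => M.softAdvantage lam θ s a ^ 2) (fun i _ => sq_nonneg _)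
        (Finset.mem_univ a))
  have hδ : M.objective lam πstar - M.objective lam π ≤
      ∑ s, M.occupancy πstar s * (Y s / (2 * lam)) := by
    rw [objective, objective, ← Finset.sum_sub_distrib]
    simp only [← mul_sub, ← Pi.sub_apply]
    rw [value_sub_value hstar, sum_init_mul_resolvent_mulVec]
    exact Finset.sum_le_sum fun s _ => mul_le_mul_of_nonneg_left (hgap s)
      (occupancy_nonneg hstar s)
  have hD0 : 0 ≤ D := norm_nonneg _
  -- Change of measure: D compares the optimal visitation with μ, and μ lies below the occupancy of
  -- every policy.
  have hocc : ∀ s, (1 - M.γ) * M.occupancy πstar s ≤ D * M.occupancy π s := by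
    intro s
    rw [← visitation_eq]
    refine le_trans ?_ (mul_le_mul_of_nonneg_left (init_le_occupancy hπ s) hD0)
    rw [← div_le_iff₀ (hμ s)]
    exact apply_le_norm (fun s => M.visitation πstar s / M.μ s) s
  have hG : ‖M.pgGrad lam θ‖ ^ 2 =
      ∑ s, ∑ a, (M.occupancy π s * (π s a * M.softAdvantage lam θ s a)) ^ 2 := by
    rw [EuclideanSpace.real_norm_sq_eq, Fintype.sum_prod_type]
    rfl
  have hrow : ∀ s, m * c * (M.occupancy π s * Y s) ≤
      ∑ a, (M.occupancy π s * (π s a * M.softAdvantage lam θ s a)) ^ 2 := by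
    intro s
    simp only [hY, Finset.mul_sum]
    refine Finset.sum_le_sum fun a _ => ?_
    have h1 : m * c ≤ M.occupancy π s * π s a ^ 2 :=
      mul_le_mul ((hmμ s).trans (init_le_occupancy hπ s)) (hcπ s a) hc (occupancy_nonneg hπ s)
    calc m * c * (M.occupancy π s * M.softAdvantage lam θ s a ^ 2)
        ≤ M.occupancy π s * π s a ^ 2 * (M.occupancy π s * M.softAdvantage lam θ s a ^ 2) :=
          mul_le_mul_of_nonneg_right h1 (mul_nonneg (occupancy_nonneg hπ s) (sq_nonneg _))
      _ = _ := by ring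
  calc 2 * lam * (1 - M.γ) * m * c * (M.objective lam πstar - M.objective lam π)
      ≤ 2 * lam * (1 - M.γ) * m * c * ∑ s, M.occupancy πstar s * (Y s / (2 * lam)) :=
        mul_le_mul_of_nonneg_left hδ (by positivity)
    _ = ∑ s, m * c * (((1 - M.γ) * M.occupancy πstar s) * Y s) := by
        rw [Finset.mul_sum]
        refine Finset.sum_congr rfl fun s _ => ?_
        field_simp
    _ ≤ ∑ s, m * c * ((D * M.occupancy π s) * Y s) :=
        Finset.sum_le_sum fun s _ => mul_le_mul_of_nonneg_left
          (mul_le_mul_of_nonneg_right (hocc s) (hY0 s)) (mul_nonneg hm hc)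
    _ = D * ∑ s, m * c * (M.occupancy π s * Y s) := by
        rw [Finset.mul_sum]
        exact Finset.sum_congr rfl fun s _ => by ring
    _ ≤ D * ‖M.pgGrad lam θ‖ ^ 2 := by
        rw [hG]
        exact mul_le_mul_of_nonneg_left (Finset.sum_le_sum fun s _ => hrow s) hD0

/-! ### Ascent along the iterates and lower bounds on their probabilities. -/

section Iterates

theorem pgRate_pos {lam : ℝ} (hlam : 0 < lam) : 0 < M.pgRate lam := by
  have := M.one_sub_discount_pos
  have := log_card_nonneg A
  rw [pgRate]
  positivity

theorem pgParam_succ {lam : ℝ} (hlam : 0 ≤ lam) (η : ℝ) (θ₀ : EuclideanSpace ℝ (S × A)) (t : ℕ) :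
    M.pgParam lam η θ₀ (t + 1) =
      M.pgParam lam η θ₀ t + η • M.pgGrad lam (M.pgParam lam η θ₀ t) := by
  rw [pgParam, (M.hasGradientAt_objective_softmaxPolicy hlam _).gradient]

theorem objective_pgPolicy_succ_ge {lam : ℝ} (hlam : 0 < lam) (θ₀ : EuclideanSpace ℝ (S × A))
    (t : ℕ) :
    M.objective lam (M.pgPolicy lam θ₀ t) + 3 / 4 * M.pgRate lam *
        ‖M.pgGrad lam (M.pgParam lam (M.pgRate lam) θ₀ t)‖ ^ 2 ≤
      M.objective lam (M.pgPolicy lam θ₀ (t + 1)) := by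
  simp only [pgPolicy, pgParam_succ hlam.le]
  set θ := M.pgParam lam (M.pgRate lam) θ₀ t
  set η := M.pgRate lam with hη
  have h := M.objective_softmaxPolicy_add_ge hlam.le θ (η • M.pgGrad lam θ)
  rw [inner_smul_right, real_inner_self_eq_norm_sq, norm_smul, mul_pow, Real.norm_eq_abs,
    sq_abs] at h
  -- The rate is a quarter of the inverse of the quadratic coefficient, so the second-order loss is
  -- a quarter of the first-order gain.
  have e : (2 + lam * (1 + 2 * Real.log (Fintype.card A))) / (1 - M.γ) ^ 3 * η = 1 / 4 := by
    have := M.one_sub_discount_pos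
    have := log_card_nonneg A
    rw [hη, pgRate]
    field_simp
    ring
  have e2 : (2 + lam * (1 + 2 * Real.log (Fintype.card A))) / (1 - M.γ) ^ 3 *
      (η ^ 2 * ‖M.pgGrad lam θ‖ ^ 2) = 1 / 4 * η * ‖M.pgGrad lam θ‖ ^ 2 := by
    rw [← e]; ring
  rw [e2] at h
  linarith

/-- Advantages have mean zero under their own policy; hence the row sums of θ are conserved. -/
theorem sum_pgGrad_row (lam : ℝ) (θ : EuclideanSpace ℝ (S × A)) (s : S) :
    ∑ a, M.pgGrad lam θ (s, a) = 0 := by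
  simp only [pgGrad, ← Finset.mul_sum, softAdvantage, value_softmaxPolicy]
  exact mul_eq_zero_of_right _ (sum_softmaxVec_mul_sub (fun a => θ (s, a)) _)

theorem sum_pgParam_row {lam : ℝ} (hlam : 0 ≤ lam) (η : ℝ) (θ₀ : EuclideanSpace ℝ (S × A))
    (t : ℕ) (s : S) : ∑ a, M.pgParam lam η θ₀ t (s, a) = ∑ a, θ₀ (s, a) := by
  induction t with
  | zero => rfl
  | succ t ih =>
    simp only [pgParam_succ hlam, PiLp.add_apply, PiLp.smul_apply, smul_eq_mul,
      Finset.sum_add_distrib, ← Finset.mul_sum, sum_pgGrad_row, ih, mul_zero, add_zero]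

theorem neg_valueBound_div_le_pgGrad {lam : ℝ} (hlam : 0 ≤ lam) (θ : EuclideanSpace ℝ (S × A))
    (x : S × A) : -(M.valueBound lam / (1 - M.γ)) ≤ M.pgGrad lam θ x := by
  have hπ : IsPolicy (softmaxPolicy θ) := isPolicy_softmaxPolicy θ
  have hB := M.valueBound_pos hlam
  have h1 : -M.valueBound lam ≤ M.softAdvantage lam θ x.1 x.2 := by
    have := softGain_nonneg hlam (qValue_nonneg (M := M) hlam hπ x.1) (fun a => θ (x.1, a)) x.2
    have := value_le (M := M) hlam hπ x.1
    rw [softAdvantage]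
    linarith
  have h2 : -M.valueBound lam ≤ softmaxPolicy θ x.1 x.2 * M.softAdvantage lam θ x.1 x.2 := by
    have h3 := mul_le_mul_of_nonneg_left h1 ((hπ x.1).1 x.2)
    have h4 := mul_le_mul_of_nonneg_right
      (softmaxVec_le_one (fun a => θ (x.1, a)) x.2) hB.le
    change softmaxPolicy θ x.1 x.2 * _ ≤ _ at h4
    linarith
  have h3 := mul_le_mul_of_nonneg_left h2 (occupancy_nonneg (M := M) hπ x.1)
  have h4 := mul_le_mul_of_nonneg_right (occupancy_le (M := M) hπ x.1) hB.le
  have e : 1 / (1 - M.γ) * M.valueBound lam = M.valueBound lam / (1 - M.γ) := by ring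
  change _ ≤ M.occupancy (softmaxPolicy θ) x.1 *
    (softmaxPolicy θ x.1 x.2 * M.softAdvantage lam θ x.1 x.2)
  linarith

/-- Once -λ log π(a|s) exceeds the bound on values, the entropy bonus alone makes the advantage
nonnegative. -/
theorem pgGrad_nonneg_of_log_le {lam : ℝ} (hlam : 0 < lam) (θ : EuclideanSpace ℝ (S × A))
    (s : S) (a : A)
    (h : Real.log (softmaxVec (fun a => θ (s, a)) a) ≤ -(M.valueBound lam / lam)) :
    0 ≤ M.pgGrad lam θ (s, a) := by
  have hπ : IsPolicy (softmaxPolicy θ) := isPolicy_softmaxPolicy θ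
  refine mul_nonneg (occupancy_nonneg hπ s) (mul_nonneg ((hπ s).1 a) ?_)
  have h1 := mul_le_mul_of_nonneg_left h hlam.le
  have e : lam * -(M.valueBound lam / lam) = -M.valueBound lam := by field_simp
  have h2 := qValue_nonneg (M := M) hlam.le hπ s a
  have h3 := value_le (M := M) hlam.le hπ s
  change 0 ≤ softGain lam (M.qValue lam (softmaxPolicy θ) s) (fun a => θ (s, a)) a -
    M.value lam (softmaxPolicy θ) s
  rw [softGain]
  linarith

theorem mean_le_log_sum_exp (z : A → ℝ) :
    (∑ a, z a) / Fintype.card A ≤ Real.log (∑ a, Real.exp (z a)) := by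
  rw [div_le_iff₀ (by exact_mod_cast Fintype.card_pos), mul_comm, ← nsmul_eq_mul,
    ← Finset.card_univ]
  refine Finset.sum_le_card_nsmul _ _ _ fun a _ => ?_
  rw [Real.le_log_iff_exp_le (sum_exp_pos z)]
  exact Finset.single_le_sum (f := fun a => Real.exp (z a)) (fun i _ => (Real.exp_pos _).le)
    (Finset.mem_univ a)

/-- A coordinate with small probability does not decrease. Otherwise it lies within `valueBound`/λ
of the log-sum-exp, which is at least the conserved row mean, and one step lowers it by a bounded
amount. -/
theorem pgParam_ge {lam η : ℝ} (hlam : 0 < lam) (hη : 0 ≤ η) (θ₀ : EuclideanSpace ℝ (S × A))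
    (t : ℕ) (s : S) (a : A) :
    min (θ₀ (s, a)) ((∑ b, θ₀ (s, b)) / Fintype.card A - M.valueBound lam / lam -
      η * (M.valueBound lam / (1 - M.γ))) ≤ M.pgParam lam η θ₀ t (s, a) := by
  induction t with
  | zero => exact min_le_left _ _
  | succ t ih =>
    rw [pgParam_succ hlam.le, PiLp.add_apply, PiLp.smul_apply, smul_eq_mul]
    have hsum := sum_pgParam_row (M := M) hlam.le η θ₀ t s
    set θ := M.pgParam lam η θ₀ t
    by_cases h : Real.log (softmaxVec (fun a => θ (s, a)) a) ≤ -(M.valueBound lam / lam)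
    · have := mul_nonneg hη (pgGrad_nonneg_of_log_le hlam θ s a h)
      linarith
    · refine (min_le_right _ _).trans ?_
      have h1 := mul_le_mul_of_nonneg_left (neg_valueBound_div_le_pgGrad (M := M) hlam.le θ (s, a)) hη
      have h2 := mean_le_log_sum_exp fun a => θ (s, a)
      rw [hsum] at h2
      rw [log_softmaxVec] at h
      linarith

/-- The policies along policy gradient are bounded away from zero. -/
theorem exists_pos_le_pgPolicy {lam : ℝ} (hlam : 0 < lam) (θ₀ : EuclideanSpace ℝ (S × A)) :
    ∃ κ > 0, ∀ t s a, κ ≤ M.pgPolicy lam θ₀ t s a := by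
  have := M.nonempty_states
  let L : S → A → ℝ := fun s a => min (θ₀ (s, a)) ((∑ b, θ₀ (s, b)) / Fintype.card A -
    M.valueBound lam / lam - M.pgRate lam * (M.valueBound lam / (1 - M.γ)))
  have hL : ∀ t s a, L s a ≤ M.pgParam lam (M.pgRate lam) θ₀ t (s, a) :=
    fun t s a => pgParam_ge hlam (pgRate_pos hlam).le θ₀ t s a
  -- Lower bounds on all coordinates and a fixed row sum give an upper bound on each.
  let U : S → ℝ := fun s => ∑ b, θ₀ (s, b) + ∑ b, |L s b|
  have hU : ∀ t s a, M.pgParam lam (M.pgRate lam) θ₀ t (s, a) ≤ U s := by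
    intro t s a
    change _ ≤ ∑ b, θ₀ (s, b) + ∑ b, |L s b|
    rw [← sum_pgParam_row (M := M) hlam.le (M.pgRate lam) θ₀ t s,
      ← Finset.sum_add_distrib]
    refine (le_add_of_nonneg_right (abs_nonneg (L s a))).trans
      (Finset.single_le_sum (f := fun b => M.pgParam lam (M.pgRate lam) θ₀ t (s, b) + |L s b|)
        (fun b _ => ?_) (Finset.mem_univ a))
    have := hL t s b
    have := neg_abs_le (L s b)
    linarith
  let κ : S × A → ℝ := fun x => Real.exp (L x.1 x.2) / (Fintype.card A * Real.exp (U x.1))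
  obtain ⟨x, hx⟩ := Finite.exists_min κ
  have hcard : (0 : ℝ) < Fintype.card A := by exact_mod_cast Fintype.card_pos
  refine ⟨κ x, by positivity, fun t s a => (hx (s, a)).trans ?_⟩
  refine div_le_div₀ (Real.exp_pos _).le (Real.exp_le_exp.2 (hL t s a)) (sum_exp_pos _) ?_
  rw [← nsmul_eq_mul, ← Finset.card_univ]
  exact Finset.sum_le_card_nsmul _ _ _ fun b _ => Real.exp_le_exp.2 (hU t s b)

end Iterates

end FiniteMDP

/-! ### Geometric convergence and the time bound. -/

namespace FiniteMDP

variable {S A : Type*} [Fintype S] [DecidableEq S] [Fintype A] [Nonempty A] {M : FiniteMDP S A}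

theorem init_le_one (M : FiniteMDP S A) (s : S) : M.μ s ≤ 1 := by
  rw [← M.μ_mem.2]
  exact Finset.single_le_sum (f := M.μ) (fun i _ => M.μ_mem.1 i) (Finset.mem_univ s)

theorem pgMinProbSq_pos {lam : ℝ} (hlam : 0 < lam) (θ₀ : EuclideanSpace ℝ (S × A)) :
    0 < M.pgMinProbSq lam θ₀ := by
  have := M.nonempty_states
  obtain ⟨κ, hκ, h⟩ := exists_pos_le_pgPolicy (M := M) hlam θ₀
  exact (pow_pos hκ 2).trans_le (le_ciInf fun t => le_ciInf fun s => le_ciInf fun a =>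
    pow_le_pow_left₀ hκ.le (h (t + 1) s a) 2)

theorem pgMinProbSq_le (lam : ℝ) (θ₀ : EuclideanSpace ℝ (S × A)) (t : ℕ) (s : S) (a : A) :
    M.pgMinProbSq lam θ₀ ≤ M.pgPolicy lam θ₀ (t + 1) s a ^ 2 := by
  have hbdd : BddBelow (Set.range fun t : ℕ =>
      ⨅ s : S, ⨅ a : A, M.pgPolicy lam θ₀ (t + 1) s a ^ 2) := by
    refine ⟨0, ?_⟩
    rintro _ ⟨t, rfl⟩
    exact Real.iInf_nonneg fun s => Real.iInf_nonneg fun a => sq_nonneg _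
  exact (ciInf_le hbdd t).trans ((ciInf_le (Set.finite_range _).bddBelow s).trans
    (ciInf_le (Set.finite_range _).bddBelow a))

theorem iInf_init_pos (hμ : ∀ s, 0 < M.μ s) : 0 < ⨅ s, M.μ s := by
  have := M.nonempty_states
  obtain ⟨s, hs⟩ := exists_eq_ciInf_of_finite (f := M.μ)
  rw [← hs]
  exact hμ s

theorem iInf_init_le (s : S) : ⨅ s, M.μ s ≤ M.μ s :=
  ciInf_le (Set.finite_range _).bddBelow s

theorem one_sub_discount_le_norm (hμ : ∀ s, 0 < M.μ s) {π : S → A → ℝ} (hπ : IsPolicy π) :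
    1 - M.γ ≤ ‖fun s => M.visitation π s / M.μ s‖ := by
  obtain ⟨s⟩ := M.nonempty_states
  exact (one_sub_discount_le_visitation_div hμ hπ s).trans
    (apply_le_norm (fun s => M.visitation π s / M.μ s) s)

theorem pgConst_pos (hμ : ∀ s, 0 < M.μ s) {lam : ℝ} (hlam : 0 < lam) {πstar : S → A → ℝ}
    (hstar : IsPolicy πstar) (θ₀ : EuclideanSpace ℝ (S × A)) :
    0 < M.pgConst lam πstar θ₀ := by
  have := M.nonempty_states
  have h1 := pgMinProbSq_pos (M := M) hlam θ₀
  have h2 := M.one_sub_discount_pos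
  have h3 := iInf_init_pos hμ
  have h4 := h2.trans_le (one_sub_discount_le_norm hμ hstar)
  have h5 := log_card_nonneg A
  have h6 : (0 : ℝ) < Fintype.card S := by exact_mod_cast Fintype.card_pos
  rw [pgConst]
  positivity

/-- Forces the time to be at least 4, which leaves room to absorb the uncontrolled first step. -/
theorem pgConst_le (hμ : ∀ s, 0 < M.μ s) {lam : ℝ} (hlam : 0 < lam) {πstar : S → A → ℝ}
    (hstar : IsPolicy πstar) (θ₀ : EuclideanSpace ℝ (S × A)) :
    M.pgConst lam πstar θ₀ ≤ 1 / 4 := by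
  have := M.nonempty_states
  obtain ⟨s⟩ := M.nonempty_states
  have hx := M.one_sub_discount_pos
  have hc : M.pgMinProbSq lam θ₀ ≤ 1 :=
    (pgMinProbSq_le lam θ₀ 0 s (Classical.arbitrary A)).trans
      (pow_le_one₀ (softmaxVec_pos (fun a => M.pgParam lam (M.pgRate lam) θ₀ (0 + 1) (s, a)) _).le
        (softmaxVec_le_one (fun a => M.pgParam lam (M.pgRate lam) θ₀ (0 + 1) (s, a)) _))
  have hm : ⨅ s, M.μ s ≤ 1 := (iInf_init_le s).trans (M.init_le_one s)
  have hm0 := iInf_init_pos hμ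
  have hc0 := pgMinProbSq_pos (M := M) hlam θ₀
  have hH := log_card_nonneg A
  have hn : (1 : ℝ) ≤ Fintype.card S := by exact_mod_cast Fintype.card_pos
  have hden : 4 ≤ (8 / lam + 4 + 8 * Real.log (Fintype.card A)) * Fintype.card S := by
    have h1 : 4 ≤ 8 / lam + 4 + 8 * Real.log (Fintype.card A) := by
      have := div_pos (show (0 : ℝ) < 8 by norm_num) hlam
      linarith
    nlinarith
  have hnum : M.pgMinProbSq lam θ₀ * (1 - M.γ) ^ 4 * (⨅ s, M.μ s) ≤ 1 - M.γ := by
    have h1 : (1 - M.γ) ^ 4 ≤ 1 - M.γ :=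
      pow_le_of_le_one hx.le (by linarith [M.discount_nonneg]) (by norm_num)
    calc M.pgMinProbSq lam θ₀ * (1 - M.γ) ^ 4 * (⨅ s, M.μ s)
        ≤ 1 * (1 - M.γ) * 1 := by gcongr
      _ = _ := by ring
  have hinv := inv_anti₀ hx (one_sub_discount_le_norm hμ hstar)
  calc M.pgConst lam πstar θ₀ ≤ (1 - M.γ) / 4 * (1 - M.γ)⁻¹ := by
        rw [pgConst]
        exact mul_le_mul (div_le_div₀ hx.le hnum (by norm_num) hden) hinv
          (inv_nonneg.2 (norm_nonneg _)) (by positivity)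
    _ = 1 / 4 := by field_simp

theorem suboptimality_succ_le (hμ : ∀ s, 0 < M.μ s) {lam : ℝ} (hlam : 0 < lam)
    {πstar : S → A → ℝ} (hstar : M.IsOptimalPolicy lam πstar)
    (θ₀ : EuclideanSpace ℝ (S × A)) (t : ℕ) :
    M.objective lam πstar - M.objective lam (M.pgPolicy lam θ₀ (t + 2)) ≤
      (1 - 3 / 2 * M.pgConst lam πstar θ₀) *
        (M.objective lam πstar - M.objective lam (M.pgPolicy lam θ₀ (t + 1))) := by
  have := M.nonempty_states
  have hx := M.one_sub_discount_pos
  have hstep := objective_pgPolicy_succ_ge (M := M) hlam θ₀ (t + 1)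
  have hδ := sub_nonneg.2 (hstar.2 (M.pgPolicy lam θ₀ (t + 1)) (isPolicy_softmaxPolicy _))
  have hloj := lojasiewicz hμ hlam hstar.1 (M.pgParam lam (M.pgRate lam) θ₀ (t + 1))
    (pgMinProbSq_pos (M := M) hlam θ₀).le (iInf_init_pos hμ).le
    (pgMinProbSq_le lam θ₀ t) iInf_init_le
  change _ * (M.objective lam πstar - M.objective lam (M.pgPolicy lam θ₀ (t + 1))) ≤ _ at hloj
  set δ := M.objective lam πstar - M.objective lam (M.pgPolicy lam θ₀ (t + 1)) with hδd
  set g := ‖M.pgGrad lam (M.pgParam lam (M.pgRate lam) θ₀ (t + 1))‖ ^ 2 with hg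
  have hD := hx.trans_le (one_sub_discount_le_norm hμ hstar.1)
  have hH := log_card_nonneg A
  have hn : (1 : ℝ) ≤ Fintype.card S := by exact_mod_cast Fintype.card_pos
  have hC := pgConst_pos hμ hlam hstar.1 θ₀
  have hη := pgRate_pos (M := M) hlam
  set D := ‖fun s => M.visitation πstar s / M.μ s‖ with hDd
  have hkey : 3 / 2 * M.pgConst lam πstar θ₀ * Fintype.card S * δ ≤
      3 / 4 * M.pgRate lam * g := by
    have e : 3 / 2 * M.pgConst lam πstar θ₀ * Fintype.card S * δ =
        3 / 4 * M.pgRate lam * ((2 * lam * (1 - M.γ) * (⨅ s, M.μ s) * M.pgMinProbSq lam θ₀ * δ)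
          / D) := by
      rw [pgConst, pgRate, ← hDd]
      have h1 : (8 / lam + 4 + 8 * Real.log (Fintype.card A)) =
          (8 + lam * (4 + 8 * Real.log (Fintype.card A))) / lam := by
        field_simp
        ring
      have h2 : 0 < 8 + lam * (4 + 8 * Real.log (Fintype.card A)) := by positivity
      rw [h1]
      field_simp
      ring
    rw [e]
    refine mul_le_mul_of_nonneg_left ?_ (by positivity)
    rw [div_le_iff₀ hD]
    linarith
  -- The statewise Łojasiewicz estimate loses no factor |S|, so the |S| in the rate is slack.
  have h3 : 3 / 2 * M.pgConst lam πstar θ₀ * δ ≤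
      3 / 2 * M.pgConst lam πstar θ₀ * Fintype.card S * δ :=
    mul_le_mul_of_nonneg_right (le_mul_of_one_le_right (by positivity) hn) hδ
  linarith

/-- The exponent counts t steps for t + 1 iterations: the step from `θ₀` is only known not to
decrease the objective. -/
theorem suboptimality_le (hμ : ∀ s, 0 < M.μ s) {lam : ℝ} (hlam : 0 < lam)
    {πstar : S → A → ℝ} (hstar : M.IsOptimalPolicy lam πstar)
    (θ₀ : EuclideanSpace ℝ (S × A)) (t : ℕ) :
    M.objective lam πstar - M.objective lam (M.pgPolicy lam θ₀ (t + 1)) ≤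
      Real.exp (-(3 / 2 * M.pgConst lam πstar θ₀ * t)) *
        (M.objective lam πstar - M.objective lam (M.pgPolicy lam θ₀ 0)) := by
  induction t with
  | zero =>
    have h1 := objective_pgPolicy_succ_ge (M := M) hlam θ₀ 0
    have h2 := mul_nonneg (mul_nonneg (show (0 : ℝ) ≤ 3 / 4 by norm_num)
      (pgRate_pos (M := M) hlam).le)
      (sq_nonneg ‖M.pgGrad lam (M.pgParam lam (M.pgRate lam) θ₀ 0)‖)
    simp only [Nat.cast_zero, mul_zero, neg_zero, Real.exp_zero, one_mul]
    linarith
  | succ t ih =>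
    refine (suboptimality_succ_le hμ hlam hstar θ₀ t).trans ?_
    have h1 : 1 - 3 / 2 * M.pgConst lam πstar θ₀ ≤
        Real.exp (-(3 / 2 * M.pgConst lam πstar θ₀)) := by
      have := Real.add_one_le_exp (-(3 / 2 * M.pgConst lam πstar θ₀))
      linarith
    have hδ := sub_nonneg.2 (hstar.2 (M.pgPolicy lam θ₀ (t + 1)) (isPolicy_softmaxPolicy _))
    refine (mul_le_mul h1 ih hδ (Real.exp_pos _).le).trans_eq ?_
    rw [← mul_assoc, ← Real.exp_add]
    push_cast
    ring_nf

theorem satisfiesPropI_pgPolicy (hμ : ∀ s, 0 < M.μ s) {lam : ℝ} (hlam : 0 < lam)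
    {πstar : S → A → ℝ} (hstar : M.IsOptimalPolicy lam πstar) :
    M.SatisfiesPropI lam πstar (M.pgPolicy lam) (M.pgTime lam πstar) 0 := by
  intro θ₀ T hT s
  have hx := M.one_sub_discount_pos
  have hC := pgConst_pos hμ hlam hstar.1 θ₀
  have hC4 := pgConst_le hμ hlam hstar.1 θ₀
  have hN : 1 / M.μ s ≤ ‖fun s => 1 / M.μ s‖ := apply_le_norm (fun s => 1 / M.μ s) s
  have hN1 : 1 ≤ 1 / M.μ s := (one_le_div (hμ s)).2 (M.init_le_one s)
  rw [pgTime] at hT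
  set C := M.pgConst lam πstar θ₀ with hCd
  set N := ‖fun s => 1 / M.μ s‖ with hNd
  set E := 4 * N / (1 - M.γ) with hE
  have hE4 : 4 ≤ E := by
    rw [hE, le_div_iff₀ hx]
    nlinarith [M.discount_nonneg]
  have hE0 : 0 < E := by linarith
  have hlog : Real.log E ≤ C * T := by
    rw [one_div, inv_mul_le_iff₀ hC] at hT
    exact hT
  have hlog1 : 1 ≤ Real.log E := by
    rw [Real.le_log_iff_exp_le hE0]
    linarith [Real.exp_one_lt_three]
  -- From 1 ≤ log E ≤ C T and C ≤ 1/4.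
  have hT4 : (4 : ℝ) ≤ T := by
    have h0 : (0 : ℝ) ≤ T := Nat.cast_nonneg T
    nlinarith
  obtain ⟨t, rfl⟩ : ∃ t, T = t + 1 := Nat.exists_eq_succ_of_ne_zero (by
    rintro rfl
    norm_num at hT4)
  have hδ₀ := sub_nonneg.2 (hstar.2 (M.pgPolicy lam θ₀ 0) (isPolicy_softmaxPolicy _))
  have hδ := suboptimality_le hμ hlam hstar θ₀ t
  rw [← hCd] at hδ
  push_cast at hT4 hlog
  have hexp : Real.exp (-(3 / 2 * C * t)) ≤ 1 / E := by
    rw [one_div, ← Real.exp_log (inv_pos.2 hE0), Real.log_inv]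
    refine Real.exp_le_exp.2 (neg_le_neg (hlog.trans ?_))
    -- With t ≥ 3 one has (3/2)t ≥ t + 1, so the factor 3/2 recovers the missing iteration.
    nlinarith
  -- A single term is bounded by the μ-average because the gap is nonnegative in every state.
  have hlow : M.μ s * (M.value lam πstar s - M.value lam (M.pgPolicy lam θ₀ (t + 1)) s) ≤
      M.objective lam πstar - M.objective lam (M.pgPolicy lam θ₀ (t + 1)) := by
    rw [objective, objective, ← Finset.sum_sub_distrib]
    simp only [← mul_sub]
    exact Finset.single_le_sum (f := fun s => M.μ s *
      (M.value lam πstar s - M.value lam (M.pgPolicy lam θ₀ (t + 1)) s))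
      (fun i _ => mul_nonneg (hμ i).le
        (sub_nonneg.2 (hstar.value_le hμ (isPolicy_softmaxPolicy _) i))) (Finset.mem_univ s)
  have hfin := hlow.trans (hδ.trans (mul_le_mul_of_nonneg_right hexp hδ₀))
  rw [← le_div_iff₀' (hμ s)] at hfin
  rw [add_zero]
  refine hfin.trans ?_
  rw [mul_div_right_comm]
  refine mul_le_mul_of_nonneg_right ?_ hδ₀
  rw [div_div, div_le_div_iff_of_pos_left one_pos (mul_pos hE0 (hμ s)) (by norm_num), hE,
    div_mul_eq_mul_div, le_div_iff₀ hx]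
  -- Hence E μ(s) ≥ 4/(1-γ) ≥ 4, which gives the factor 1/4.
  have h1 : 1 ≤ N * M.μ s := by rwa [div_le_iff₀ (hμ s)] at hN
  nlinarith [M.discount_nonneg]

end FiniteMDP

end

theorem mainTheorem12 {S A : Type*} [Fintype S] [DecidableEq S] [Fintype A] [Nonempty A]
    (M : FiniteMDP S A) (hμ : ∀ s, 0 < M.μ s) (lam : ℝ) (hlam : 0 < lam) :
    (∃ πstar : S → A → ℝ, M.IsOptimalPolicy lam πstar) ∧
    ∀ πstar : S → A → ℝ, M.IsOptimalPolicy lam πstar →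
      (∀ θ₀ : EuclideanSpace ℝ (S × A), 0 < M.pgConst lam πstar θ₀) ∧
      M.SatisfiesPropI lam πstar (M.pgPolicy lam) (M.pgTime lam πstar) 0 := by
  exact ⟨M.exists_isOptimalPolicy lam, fun πstar hstar =>
    ⟨FiniteMDP.pgConst_pos hμ hlam hstar.1, FiniteMDP.satisfiesPropI_pgPolicy hμ hlam hstar⟩⟩
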